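/- **Setting.** Let $F:\mathbb R^n\rightrightarrows\mathbb R^q$ be a polyhedral convex set-valued mapping, i.e. its graph $\operatorname{gr}F=\{(x,y): y\in F(x)\}$ is a convex polyhedron (a finite intersection of closed half-spaces, possibly empty), and let $C\subseteq\mathbb R^q$ be a polyhedral convex cone with nonempty interior. Put $\operatorname{dom}F=\{x: F(x)\ne\emptyset\}$. The recession mapping $G:\mathbb R^n\rightrightarrows\mathbb R^q$ of $F$ is defined by $\operatorname{gr}G=0^+\operatorname{gr}F$, where $0^+A=\{v: a+tv\in A\ \forall a\in A,\ t\ge 0\}$. Assume that $G(0)=C$ if $\operatorname{gr}F\neq\emptyset$ (nothing is required of $G(0)$ if $\operatorname{gr}F=\emptyset$). Consider the problem $$\text{(P)}\qquad \min F(x)+C\quad\text{s.t. } x\in\mathbb R^n$$ with respect to $\supseteq$, with upper image $\mathcal P=C+\bigcup_{x\in\mathbb R^n}F(x)$. **Solutions.** A point $\bar x\in\operatorname{dom}F$ is a minimizing point of (P) if there is no $x\in\mathbb R^n$ with $F(x)+C\supsetneq F(\bar x)+C$. A nonzero $\hat x\in\operatorname{dom}G$ is a minimizing direction of (P) if there is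 no $x\in\mathbb R^n$ with $G(x)+C\supsetneq G(\hat x)+C$. A pair $(\bar S,\hat S)$ of finite sets $\emptyset\ne\bar S\subseteq\operatorname{dom}F$, $\hat S\subseteq\operatorname{dom}G\setminus\{0\}$ is a finite infimizer if $$\mathcal P\subseteq C+\operatorname{conv}\bigcup_{x\in\bar S}F(x)+\operatorname{cone}\bigcup_{x\in\hat S}G(x),$$ where $\operatorname{cone}$ denotes the convex conic hull (containing $0$, $\operatorname{cone}\emptyset=\{0\}$). It is a solution of (P) if, moreover, all elements of $\bar S$ are minimizing points and all elements of $\hat S$ are minimizing directions. **The function** $\texttt{ComputeMinimizer}(H,C,\bar y)$ for $H:\mathbb R^n\rightrightarrows\mathbb R^q$. A minimal system of outer normals of a polyhedral convex set $A\subseteq\mathbb R^q$ is a set $\{w^1,\dots,w^k\}$ of Euclidean unit vectors with $A=\{y: y^Tw^i\le\gamma_i,\ i=1,\dots,k\}$ for some $\gamma_i\in\mathbb R$, with $k$ minimal. 1. Choose $\bar x$ with $\bar y\in H(\bar x)+C$; let $N$ be a minimal system of outer normals of $H(\bar x)+C$; let $W=\emptyset$. 2. As long as $N\not\subseteq W$: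 choose $w\in N\setminus W$, replace $W$ by $W\cup\{w\}$, and consider the linear program $$\max_{x,y}\ w^Ty\quad\text{s.t.}\quad y\in H(x)+C,\quad H(\bar x)+C\subseteq H(x)+C.$$ If it has no optimal solution, return $\emptyset$. Otherwise take an optimal solution $(x^*,y^*)$; if $y^*\notin H(\bar x)+C$, replace $\bar x$ by $x^*$ and $N$ by a minimal system of outer normals of $H(\bar x)+C$ for the new $\bar x$. 3. When $N\subseteq W$ (in particular at once if $N=\emptyset$), return $\{\bar x\}$. **The solution method** for (P). 1. Let $\bar S=\hat S=\emptyset$. If $\mathcal P=\emptyset$, or else if $\texttt{ComputeMinimizer}(G,C,0)$ returns $\emptyset$, stop and report that there is no solution. 2. Otherwise compute a V-representation of $\mathcal P$, that is, finite sets $P,D\subseteq\mathbb R^q$ with $\mathcal P=\operatorname{conv}P+\operatorname{cone}D$, and replace $D$ by $D\setminus C$. 3. For each $y\in P$, replace $\bar S$ by $\bar S\cup\texttt{ComputeMinimizer}(F,C,y)$. 4. For each $y\in D$, replace $\hat S$ by $\hat S\cup\texttt{ComputeMinimizer}(G,C,y)$. Return $(\bar S,\hat S)$. Choices, optimal solutions,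 V-representations, and the orders in which $P$ and $D$ are run through are arbitrary. A step is one execution of an instruction above; finding a point $\bar x$, a minimal system of outer normals, an optimal solution (or the fact that there is none), and a V-representation are elementary operations. **Theorem.** Whatever choices are made, the solution method terminates after finitely many steps: there is no infinite run, and no run reaches an instruction that cannot be carried out. If (P) has a solution, every run returns a solution $(\bar S,\hat S)$ of (P). If (P) has no solution, every run stops with the report that there is no solution. -/

import Mathlib

open scoped Pointwise

namespace PolySetOpt

/-- Euclidean space `ℝⁿ`. -/
abbrev Euc (n : ℕ) : Type := EuclideanSpace ℝ (Fin n)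

/-! ### Polyhedral convex sets and set-valued mappings -/

/-- A convex polyhedron: the solution set of finitely many (non-strict) affine inequalities. -/
def IsPolyhedron {V : Type*} [AddCommGroup V] [Module ℝ V] (A : Set V) : Prop :=
  ∃ (m : ℕ) (a : Fin m → V →ₗ[ℝ] ℝ) (b : Fin m → ℝ), A = {x | ∀ i, a i x ≤ b i}

/-- The recession cone `0⁺A`. -/
def recCone {V : Type*} [AddCommGroup V] [Module ℝ V] (A : Set V) : Set V :=
  {v | ∀ a ∈ A, ∀ t : ℝ, 0 ≤ t → a + t • v ∈ A}

/-- `(P, D)` is a V-representation of `A`: finitely many points and finitely many directions with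
`A = conv P + cone D`, where `cone ∅ = {0}`. -/
def IsVRep {V : Type*} [AddCommGroup V] [Module ℝ V] (A : Set V) (P D : Finset V) : Prop :=
  A = convexHull ℝ (P : Set V) + (PointedCone.hull ℝ (D : Set V) : Set V)

variable {n q : ℕ}

/-- The graph of a set-valued mapping `F : ℝⁿ ⇉ ℝ^q`. -/
def graph (F : Euc n → Set (Euc q)) : Set (Euc n × Euc q) := {p | p.2 ∈ F p.1}

/-- The domain of a set-valued mapping. -/
def dom (F : Euc n → Set (Euc q)) : Set (Euc n) := {x | (F x).Nonempty}

/-- The recession mapping `G` of `F`, given by `gr G = 0⁺ gr F`. -/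
def recMap (F : Euc n → Set (Euc q)) : Euc n → Set (Euc q) :=
  fun x => {y | (x, y) ∈ recCone (graph F)}

/-! ### The set optimization problem `min F(x) + C` -/

/-- The upper image `C + ⋃ₓ F(x)`. -/
def upperImage (F : Euc n → Set (Euc q)) (C : PointedCone ℝ (Euc q)) : Set (Euc q) :=
  (C : Set (Euc q)) + ⋃ x, F x

/-- `x ∈ dom F` is a minimizer of `F` with respect to `C`. -/
def IsMinimizer (F : Euc n → Set (Euc q)) (C : PointedCone ℝ (Euc q)) (x : Euc n) : Prop :=
  x ∈ dom F ∧ ¬ ∃ x' : Euc n, F x + (C : Set (Euc q)) ⊂ F x' + (C : Set (Euc q))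

/-- Minimizing points of the problem. -/
def IsMinimizingPoint (F : Euc n → Set (Euc q)) (C : PointedCone ℝ (Euc q)) (x : Euc n) : Prop :=
  IsMinimizer F C x

/-- Minimizing directions of the problem: nonzero minimizers of the recession mapping. -/
def IsMinimizingDirection (F : Euc n → Set (Euc q)) (C : PointedCone ℝ (Euc q)) (x : Euc n) :
    Prop :=
  x ≠ 0 ∧ IsMinimizer (recMap F) C x

/-- Finite infimizers `(S̄, Ŝ)`. -/
structure IsFiniteInfimizer (F : Euc n → Set (Euc q)) (C : PointedCone ℝ (Euc q))
    (S T : Set (Euc n)) : Prop where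
  finite_points : S.Finite
  finite_directions : T.Finite
  nonempty_points : S.Nonempty
  points_subset : S ⊆ dom F
  directions_subset : T ⊆ dom (recMap F) \ {0}
  upperImage_subset : upperImage F C ⊆
    (C : Set (Euc q)) + convexHull ℝ (⋃ x ∈ S, F x)
      + (PointedCone.hull ℝ (⋃ x ∈ T, recMap F x) : Set (Euc q))

/-- Solutions `(S̄, Ŝ)` of the problem. -/
def IsSolution (F : Euc n → Set (Euc q)) (C : PointedCone ℝ (Euc q)) (S T : Set (Euc n)) : Prop :=
  IsFiniteInfimizer F C S T ∧ (∀ x ∈ S, IsMinimizingPoint F C x) ∧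
    ∀ x ∈ T, IsMinimizingDirection F C x

/-! ### The function `ComputeMinimizer` -/

/-- `N` is a set of unit normal vectors of some inequality representation of `A`. -/
def IsNormalSystem (A : Set (Euc q)) (N : Finset (Euc q)) : Prop :=
  (∀ w ∈ N, ‖w‖ = 1) ∧ ∃ γ : Euc q → ℝ, A = {y | ∀ w ∈ N, inner ℝ w y ≤ γ w}

/-- `N` is a minimal system of outer normals of `A`. -/
def IsMinimalNormalSystem (A : Set (Euc q)) (N : Finset (Euc q)) : Prop :=
  IsNormalSystem A N ∧ ∀ N' : Finset (Euc q), IsNormalSystem A N' → N.card ≤ N'.card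

/-- `(x, y)` is feasible for the linear program
`max wᵀy  s.t.  y ∈ F(x) + C,  F(x̄) + C ⊆ F(x) + C`. -/
def LPFeasible (F : Euc n → Set (Euc q)) (C : PointedCone ℝ (Euc q)) (xbar : Euc n)
    (x : Euc n) (y : Euc q) : Prop :=
  y ∈ F x + (C : Set (Euc q)) ∧ F xbar + (C : Set (Euc q)) ⊆ F x + (C : Set (Euc q))

/-- `(x, y)` is an optimal solution of this linear program. -/
def LPOptimal (F : Euc n → Set (Euc q)) (C : PointedCone ℝ (Euc q)) (w : Euc q) (xbar : Euc n)
    (x : Euc n) (y : Euc q) : Prop :=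
  LPFeasible F C xbar x y ∧
    ∀ (x' : Euc n) (y' : Euc q), LPFeasible F C xbar x' y' → inner ℝ w y' ≤ inner ℝ w y

/-- Configurations of `ComputeMinimizer`: before the choice of `x̄`; in the loop with current values
of the variables `x̄`, `N`, `W`; and after returning a set. -/
inductive CMState (n q : ℕ) : Type
  | start : CMState n q
  | loop (xbar : Euc n) (N : Finset (Euc q)) (W : Set (Euc q)) : CMState n q
  | returned (S : Set (Euc n)) : CMState n q

/-- One step of `ComputeMinimizer (F, C, ȳ)`. All choices (of `x̄`, of `w ∈ N \ W` and of the
optimal solution `(x*, y*)`) are nondeterministic. The loop is left when `N ⊆ W`. -/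
inductive CMStep (F : Euc n → Set (Euc q)) (C : PointedCone ℝ (Euc q)) (ybar : Euc q) :
    CMState n q → CMState n q → Prop
  | init (x : Euc n) (N : Finset (Euc q)) (hx : ybar ∈ F x + (C : Set (Euc q)))
      (hN : IsMinimalNormalSystem (F x + (C : Set (Euc q))) N) :
      CMStep F C ybar .start (.loop x N ∅)
  | exit (x : Euc n) (N : Finset (Euc q)) (W : Set (Euc q)) (hNW : (N : Set (Euc q)) ⊆ W) :
      CMStep F C ybar (.loop x N W) (.returned {x})
  | fail (x : Euc n) (N : Finset (Euc q)) (W : Set (Euc q)) (w : Euc q) (hw : w ∈ N) (hwW : w ∉ W)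
      (hLP : ¬ ∃ (xs : Euc n) (ys : Euc q), LPOptimal F C w x xs ys) :
      CMStep F C ybar (.loop x N W) (.returned ∅)
  | keep (x : Euc n) (N : Finset (Euc q)) (W : Set (Euc q)) (w : Euc q) (hw : w ∈ N) (hwW : w ∉ W)
      (xs : Euc n) (ys : Euc q) (hLP : LPOptimal F C w x xs ys)
      (hys : ys ∈ F x + (C : Set (Euc q))) :
      CMStep F C ybar (.loop x N W) (.loop x N (insert w W))
  | update (x : Euc n) (N : Finset (Euc q)) (W : Set (Euc q)) (w : Euc q) (hw : w ∈ N)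
      (hwW : w ∉ W) (xs : Euc n) (ys : Euc q) (hLP : LPOptimal F C w x xs ys)
      (hys : ys ∉ F x + (C : Set (Euc q))) (N' : Finset (Euc q))
      (hN' : IsMinimalNormalSystem (F xs + (C : Set (Euc q))) N') :
      CMStep F C ybar (.loop x N W) (.loop xs N' (insert w W))

/-! ### The solution method -/

/-- Configurations of the solution method. `S`, `T` are the current values of `S̄`, `Ŝ`; `P`, `D` are
the points and directions that the two for-loops still have to treat. -/
inductive State (n q : ℕ) : Type
  /-- start of the method -/
  | start : State n q
  /-- evaluating `ComputeMinimizer (G, C, 0)` in the condition of the if-statement -/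
  | test (c : CMState n q) : State n q
  /-- stopped because there is no solution -/
  | noSolution : State n q
  /-- about to compute a V-representation of the upper image -/
  | vRep : State n q
  /-- head of the for-loop over the points -/
  | points (P D : Set (Euc q)) (S : Set (Euc n)) : State n q
  /-- evaluating `ComputeMinimizer (F, C, y)` in the for-loop over the points -/
  | pointCall (y : Euc q) (c : CMState n q) (P D : Set (Euc q)) (S : Set (Euc n)) : State n q
  /-- head of the for-loop over the directions -/
  | directions (D : Set (Euc q)) (S T : Set (Euc n)) : State n q
  /-- evaluating `ComputeMinimizer (G, C, y)` in the for-loop over the directions -/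
  | directionCall (y : Euc q) (c : CMState n q) (D : Set (Euc q)) (S T : Set (Euc n)) : State n q
  /-- regular end of the method -/
  | finished (S T : Set (Euc n)) : State n q

/-- One step of the solution method applied to `(F, C)`. The V-representation and the order in which
the for-loops run through their sets are nondeterministic. -/
inductive Step (F : Euc n → Set (Euc q)) (C : PointedCone ℝ (Euc q)) :
    State n q → State n q → Prop
  | infeasible (h : upperImage F C = ∅) : Step F C .start .noSolution
  | feasible (h : upperImage F C ≠ ∅) : Step F C .start (.test .start)
  | testStep (c c' : CMState n q) (h : CMStep (recMap F) C 0 c c') :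
      Step F C (.test c) (.test c')
  | testFail (R : Set (Euc n)) (h : R = ∅) : Step F C (.test (.returned R)) .noSolution
  | testPass (R : Set (Euc n)) (h : R ≠ ∅) : Step F C (.test (.returned R)) .vRep
  | compute (P D : Finset (Euc q)) (h : IsVRep (upperImage F C) P D) :
      Step F C .vRep (.points (P : Set (Euc q)) ((D : Set (Euc q)) \ (C : Set (Euc q))) ∅)
  | pointChoose (P D : Set (Euc q)) (S : Set (Euc n)) (y : Euc q) (hy : y ∈ P) :
      Step F C (.points P D S) (.pointCall y .start (P \ {y}) D S)
  | pointStep (y : Euc q) (c c' : CMState n q) (P D : Set (Euc q)) (S : Set (Euc n))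
      (h : CMStep F C y c c') :
      Step F C (.pointCall y c P D S) (.pointCall y c' P D S)
  | pointReturn (y : Euc q) (R : Set (Euc n)) (P D : Set (Euc q)) (S : Set (Euc n)) :
      Step F C (.pointCall y (.returned R) P D S) (.points P D (S ∪ R))
  | pointsDone (D : Set (Euc q)) (S : Set (Euc n)) :
      Step F C (.points ∅ D S) (.directions D S ∅)
  | directionChoose (D : Set (Euc q)) (S T : Set (Euc n)) (y : Euc q) (hy : y ∈ D) :
      Step F C (.directions D S T) (.directionCall y .start (D \ {y}) S T)
  | directionStep (y : Euc q) (c c' : CMState n q) (D : Set (Euc q)) (S T : Set (Euc n))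
      (h : CMStep (recMap F) C y c c') :
      Step F C (.directionCall y c D S T) (.directionCall y c' D S T)
  | directionReturn (y : Euc q) (R : Set (Euc n)) (D : Set (Euc q)) (S T : Set (Euc n)) :
      Step F C (.directionCall y (.returned R) D S T) (.directions D S (T ∪ R))
  | directionsDone (S T : Set (Euc n)) :
      Step F C (.directions ∅ S T) (.finished S T)

/-- `s` is reachable, i.e. occurs in some run of the method on `(F, C)`. -/
def Reachable (F : Euc n → Set (Euc q)) (C : PointedCone ℝ (Euc q)) (s : State n q) : Prop :=
  Relation.ReflTransGen (Step F C) .start s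

/-- The method has stopped: with the message that there is no solution, or regularly. -/
def State.IsFinal (s : State n q) : Prop :=
  s = .noSolution ∨ ∃ S T : Set (Euc n), s = .finished S T

end PolySetOpt

/-!
The method is a nondeterministic program, and the theorem is its total correctness: every run is
finite and ends in a correct result (`Terminates`, `terminates_start`). The mathematics is as
follows; `G` is the recession mapping of `H`, where `H` is `F` or `G` itself.

Inequalities. Eliminating variables from a finite linear system yields finitely many homogeneous
inequalities in its right-hand side, independent of that right-hand side
(`eliminable_of_finite`). Hence one elimination gives inequalities `B x + A y ≤ b` for `H + C` whose
homogeneous version describes `G + C` (`exists_isSystem`). It also shows that the upper image is a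
polyhedron whose recession directions lie in values of `G + C` (`exists_upperImage_inequalities`),
so that it has a V-representation (`exists_isVRep`) and every point or direction of one can be passed
to `ComputeMinimizer`. Finally, it shows that a feasible linear program is solvable unless its
objective increases along a recession direction (`exists_optimal_or_direction`).

The role of `0`. If `G d + C` contains `C` properly, then adding `d` to a minimizer of `H` would
enlarge its value by directions outside `C`, which is impossible; so the existence of one minimizer
forces `0` to minimize `G` (`isMinimizer_rec_zero`). Conversely, if `0` minimizes `G`, then a
recession direction of one of the linear programs with increasing objective would give such a `d`, so
all linear programs are solvable (`exists_lpOptimal`). Thus `ComputeMinimizer` returns the empty set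
exactly when `0` does not minimize `G`, and in that case there is no solution.

The loop. Values of `H + C` are full-dimensional because `C` is, and the minimal normal system of a
full-dimensional set is contained in every normal system (`IsMinimalNormalSystem.subset`). The rows of
`A` therefore provide one finite set that contains all normals that ever occur; `W` grows within this
set, so the loop ends. When it ends, the value at the current point attains, in each of its normal
directions, the maximum over all larger values, so it cannot be enlarged
(`IsSaturated.isMinimizer`).

The result. Minimizers whose values of `F + C` cover the points, and whose values of `G + C` cover the
directions outside `C`, of a V-representation of the upper image form a solution
(`isSolution_of_isVRep`).
-/

namespace PolySetOpt

/-! ### Systems of linear inequalities -/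

/-- Elimination of `W`: solvability in `W` of a finite system `c i w ≤ b i` is equivalent to finitely
many homogeneous linear inequalities in the right-hand side `b`. These inequalities depend on `c`
only, so one elimination serves a polyhedron and its recession cone simultaneously. -/
def Eliminable (W : Type*) [AddCommGroup W] [Module ℝ W] : Prop :=
  ∀ (ι : Type) [Finite ι] (c : ι → W →ₗ[ℝ] ℝ),
    ∃ (κ : Type) (_ : Finite κ) (L : κ → (ι → ℝ) →ₗ[ℝ] ℝ),
      ∀ b : ι → ℝ, (∃ w, ∀ i, c i w ≤ b i) ↔ ∀ k, 0 ≤ L k b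

lemma exists_between_of_finite {ι : Type*} [Finite ι] (s t : Set ι) (l u : ι → ℝ)
    (h : ∀ i ∈ s, ∀ j ∈ t, l i ≤ u j) :
    ∃ r, (∀ i ∈ s, l i ≤ r) ∧ ∀ j ∈ t, r ≤ u j := by
  rcases s.eq_empty_or_nonempty with rfl | hs
  · rcases t.eq_empty_or_nonempty with rfl | ht
    · exact ⟨0, by simp, by simp⟩
    · obtain ⟨j, _, hj⟩ := Set.exists_min_image t u t.toFinite ht
      exact ⟨u j, by simp, hj⟩
  · obtain ⟨i, hi, hmax⟩ := Set.exists_max_image s l s.toFinite hs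
    exact ⟨l i, hmax, fun j hj => h i hi j hj⟩

lemma eliminable_real : Eliminable ℝ := by
  classical
  intro ι _ c
  have hc : ∀ i w, c i w = c i 1 * w := fun i w => by
    rw [mul_comm, ← smul_eq_mul, ← map_smul, smul_eq_mul, mul_one]
  -- Keep the inequalities without the variable, and add each pair of opposite signs, scaled so
  -- that the variable cancels.
  refine ⟨ι ⊕ ι × ι, inferInstance, Sum.elim
    (fun i => if c i 1 = 0 then LinearMap.proj i else 0)
    (fun p => if 0 < c p.1 1 ∧ c p.2 1 < 0 then
      c p.1 1 • LinearMap.proj p.2 - c p.2 1 • LinearMap.proj p.1 else 0), fun b => ⟨?_, ?_⟩⟩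
  · rintro ⟨w, hw⟩ (i | ⟨i, j⟩)
    · by_cases h : c i 1 = 0
      · have := hw i
        rw [hc, h] at this
        simpa [h] using this
      · simp [h]
    · by_cases h : 0 < c i 1 ∧ c j 1 < 0
      · have h1 := hw i
        have h2 := hw j
        rw [hc] at h1 h2
        simp only [Sum.elim_inr, h, and_self, if_true, LinearMap.sub_apply, LinearMap.smul_apply,
          LinearMap.proj_apply, smul_eq_mul]
        nlinarith [mul_le_mul_of_nonneg_left h2 h.1.le,
          mul_le_mul_of_nonneg_left h1 (neg_nonneg.2 h.2.le)]
      · simp [h]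
  · intro h
    obtain ⟨r, hl, hu⟩ := exists_between_of_finite {j | c j 1 < 0} {i | 0 < c i 1}
      (fun j => b j / c j 1) (fun i => b i / c i 1) (by
        intro j hj i hi
        have := h (Sum.inr (i, j))
        simp only [Set.mem_ofPred_eq] at hi hj
        simp only [Sum.elim_inr, hi, hj, and_self, if_true, LinearMap.sub_apply,
          LinearMap.smul_apply, LinearMap.proj_apply, smul_eq_mul] at this
        rw [div_le_iff_of_neg hj, div_mul_eq_mul_div, div_le_iff₀ hi]
        linarith)
    refine ⟨r, fun i => ?_⟩
    rw [hc]
    rcases lt_trichotomy (c i 1) 0 with hi | hi | hi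
    · have := hl i hi
      rw [div_le_iff_of_neg hi] at this
      linarith
    · have := h (Sum.inl i)
      simp only [Sum.elim_inl, hi, if_true, LinearMap.proj_apply] at this
      rw [hi]
      linarith
    · have := hu i hi
      rw [le_div_iff₀ hi] at this
      linarith

section LinearInequalities

variable {V W : Type*} [AddCommGroup V] [Module ℝ V] [AddCommGroup W] [Module ℝ W]

lemma Eliminable.prod (hV : Eliminable V) (hW : Eliminable W) : Eliminable (V × W) := by
  intro ι _ c
  obtain ⟨κ, _, L, hL⟩ := hW ι fun i => c i ∘ₗ LinearMap.inr ℝ V W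
  obtain ⟨μ, _, M, hM⟩ := hV κ fun k => L k ∘ₗ LinearMap.pi fun i => c i ∘ₗ LinearMap.inl ℝ V W
  refine ⟨μ, inferInstance, fun m => M m ∘ₗ LinearMap.pi L, fun b => ?_⟩
  have key : ∀ v, (∃ w, ∀ i, c i (v, w) ≤ b i) ↔
      ∀ k, L k (fun i => c i (v, 0)) ≤ L k b := by
    intro v
    have h := hL (b - fun i => c i (v, 0))
    have hs : ∀ w i, c i (v, w) ≤ b i ↔ c i (0, w) ≤ b i - c i (v, 0) := fun w i => by
      rw [le_sub_iff_add_le', ← map_add, Prod.mk_add_mk, add_zero, zero_add]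
    simp only [map_sub, sub_nonneg] at h
    exact (exists_congr fun w => forall_congr' (hs w)).trans h
  have h := hM (LinearMap.pi L b)
  rw [show (∀ k, 0 ≤ (M k ∘ₗ LinearMap.pi L) b) ↔ ∀ k, 0 ≤ M k (LinearMap.pi L b) from Iff.rfl, ← h]
  refine Prod.exists.trans (exists_congr fun v => (key v).trans ?_)
  rfl

lemma Eliminable.congr (hV : Eliminable V) (e : V ≃ₗ[ℝ] W) : Eliminable W := by
  intro ι _ c
  obtain ⟨κ, hκ, L, hL⟩ := hV ι fun i => c i ∘ₗ e.toLinearMap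
  refine ⟨κ, hκ, L, fun b => (Iff.trans ?_ (hL b))⟩
  exact e.surjective.exists

lemma eliminable_of_finite [Module.Finite ℝ W] : Eliminable W := by
  have h : ∀ m : ℕ, Eliminable (Fin m → ℝ) := by
    intro m
    induction m with
    | zero =>
      intro ι _ c
      refine ⟨ι, inferInstance, fun i => LinearMap.proj i, fun b => ?_⟩
      have h : ∀ i w, c i w = 0 := fun i w => by rw [Subsingleton.elim w 0, map_zero]
      simp [h]
    | succ m ih => exact (eliminable_real.prod ih).congr (Fin.consLinearEquiv ℝ fun _ => ℝ)
  exact (h _).congr (Module.finBasis ℝ W).equivFun.symm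

/-- A feasible linear program has an optimal solution unless its objective increases along some
recession direction of the feasible set. -/
lemma exists_optimal_or_direction [Module.Finite ℝ W] {ι : Type} [Finite ι]
    (c : ι → W →ₗ[ℝ] ℝ) (b : ι → ℝ) (f : W →ₗ[ℝ] ℝ) (hne : ∃ w, ∀ i, c i w ≤ b i) :
    (∃ w, (∀ i, c i w ≤ b i) ∧ ∀ w', (∀ i, c i w' ≤ b i) → f w' ≤ f w) ∨
      ∃ d, (∀ i, c i d ≤ 0) ∧ 0 < f d := by
  -- Eliminating `w` from `c i w ≤ b i`, `t ≤ f w` describes the attainable values `t`.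
  obtain ⟨κ, _, L, hL⟩ := eliminable_of_finite (W := W) (ι ⊕ Unit) (Sum.elim c fun _ => -f)
  have hL' : ∀ (b' : ι → ℝ) (t : ℝ), (∃ w, (∀ i, c i w ≤ b' i) ∧ t ≤ f w) ↔
      ∀ k, 0 ≤ L k (Sum.elim b' fun _ => -t) := by
    intro b' t
    rw [← hL]
    refine exists_congr fun w => ?_
    simp [Sum.forall]
  by_cases hk : ∀ k, 0 ≤ L k (Sum.elim (0 : ι → ℝ) fun _ => -1)
  · obtain ⟨d, hd, h1⟩ := (hL' 0 1).2 hk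
    exact Or.inr ⟨d, hd, by linarith⟩
  left
  push Not at hk
  obtain ⟨k, hk⟩ := hk
  have hlin : ∀ k t, L k (Sum.elim b fun _ => -t) =
      L k (Sum.elim b fun _ => 0) + t * L k (Sum.elim (0 : ι → ℝ) fun _ => -1) := by
    intro k t
    rw [← smul_eq_mul, ← map_smul, ← map_add]
    congr 1
    ext (i | i) <;> simp
  set T : Set ℝ := {t | ∃ w, (∀ i, c i w ≤ b i) ∧ t ≤ f w} with hT
  have hTeq : T = ⋂ k, {t | 0 ≤ L k (Sum.elim b fun _ => 0) +
      t * L k (Sum.elim (0 : ι → ℝ) fun _ => -1)} := by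
    ext t
    simp only [hT, Set.mem_ofPred_eq, hL', Set.mem_iInter, hlin]
  have hclosed : IsClosed T := by
    rw [hTeq]
    exact isClosed_iInter fun k => isClosed_le continuous_const (by fun_prop)
  have hbdd : BddAbove T := by
    refine ⟨L k (Sum.elim b fun _ => 0) / -L k (Sum.elim (0 : ι → ℝ) fun _ => -1), fun t ht => ?_⟩
    rw [hTeq] at ht
    have := Set.mem_iInter.1 ht k
    simp only [Set.mem_ofPred_eq] at this
    rw [le_div_iff₀ (by linarith)]
    linarith
  obtain ⟨w₀, hw₀⟩ := hne
  obtain ⟨w, hw, hsup⟩ := hclosed.csSup_mem ⟨f w₀, w₀, hw₀, le_rfl⟩ hbdd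
  exact ⟨w, hw, fun w' hw' => (le_csSup hbdd ⟨w', hw', le_rfl⟩).trans hsup⟩

/-! ### Minkowski's theorem -/

lemma map_nonpos_of_mem_hull {S : Set V} {a : V →ₗ[ℝ] ℝ} (h : ∀ g ∈ S, a g ≤ 0) {x : V}
    (hx : x ∈ PointedCone.hull ℝ S) : a x ≤ 0 := by
  induction hx using Submodule.span_induction with
  | mem x hx => exact h x hx
  | zero => simp
  | add x y _ _ hx hy => rw [map_add]; linarith
  | smul r x _ hx =>
    rw [show r • x = (r : ℝ) • x from rfl, map_smul, smul_eq_mul]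
    exact mul_nonpos_of_nonneg_of_nonpos r.2 hx

/-- The double description step: intersecting a finitely generated cone with a half-space leaves it
finitely generated. -/
lemma exists_hull_eq_inter_halfspace (T : Finset V) (a : V →ₗ[ℝ] ℝ) :
    ∃ T' : Finset V, ∀ x, x ∈ PointedCone.hull ℝ (T' : Set V) ↔
      x ∈ PointedCone.hull ℝ (T : Set V) ∧ a x ≤ 0 := by
  classical
  set Tp := T.filter fun g => 0 < a g with hTp
  set Tm := T.filter fun g => a g ≤ 0 with hTm
  set T' := Tm ∪ (Tp ×ˢ Tm).image fun p => a p.1 • p.2 - a p.2 • p.1 with hT'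
  set K := PointedCone.hull ℝ (T : Set V)
  set K' := PointedCone.hull ℝ (T' : Set V)
  have hm : PointedCone.hull ℝ (Tm : Set V) ≤ K' := Submodule.span_mono (by
    rw [hT']; push_cast; exact Set.subset_union_left)
  have hma : ∀ m ∈ PointedCone.hull ℝ (Tm : Set V), a m ≤ 0 := fun m =>
    map_nonpos_of_mem_hull fun g hg => (Finset.mem_filter.1 hg).2
  have hpa : ∀ p ∈ PointedCone.hull ℝ (Tp : Set V), 0 ≤ a p ∧ (a p = 0 → p = 0) := by
    intro p h
    induction h using Submodule.span_induction with
    | mem x hx =>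
      have := (Finset.mem_filter.1 hx).2
      exact ⟨this.le, fun h => absurd h this.ne'⟩
    | zero => simp
    | add x y _ _ hx hy =>
      rw [map_add]
      refine ⟨by linarith, fun h => ?_⟩
      rw [hx.2 (by linarith), hy.2 (by linarith), add_zero]
    | smul r x _ hx =>
      rw [show r • x = (r : ℝ) • x from rfl, map_smul, smul_eq_mul]
      refine ⟨mul_nonneg r.2 hx.1, fun h => ?_⟩
      rcases mul_eq_zero.1 h with h | h
      · rw [h, zero_smul]
      · rw [hx.2 h, smul_zero]
  have hpm : ∀ p ∈ PointedCone.hull ℝ (Tp : Set V), ∀ m ∈ PointedCone.hull ℝ (Tm : Set V),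
      a p • m - a m • p ∈ K' := by
    intro p hp m hm
    induction hp using Submodule.span_induction with
    | mem g hg =>
      induction hm using Submodule.span_induction with
      | mem h hh =>
        refine Submodule.subset_span ?_
        rw [hT']
        push_cast
        exact Or.inr ⟨(g, h), ⟨hg, hh⟩, rfl⟩
      | zero => simp
      | add x y _ _ hx hy =>
        convert add_mem hx hy using 1
        rw [map_add]; module
      | smul r x _ hx =>
        convert K'.smul_mem r.2 hx using 1
        rw [show r • x = (r : ℝ) • x from rfl, map_smul, smul_eq_mul]
        module
    | zero => simp
    | add x y _ _ hx hy =>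
      convert add_mem hx hy using 1
      rw [map_add]; module
    | smul r x _ hx =>
      convert K'.smul_mem r.2 hx using 1
      rw [show r • x = (r : ℝ) • x from rfl, map_smul, smul_eq_mul]
      module
  refine ⟨T', fun x => ⟨fun h => ?_, ?_⟩⟩
  · change x ∈ K' at h
    have hK : ∀ g ∈ T, g ∈ K := fun g hg => Submodule.subset_span hg
    induction h using Submodule.span_induction with
    | mem x hx =>
      simp only [hT', Finset.coe_union, Set.mem_union, Finset.mem_coe, Finset.mem_image,
        Finset.mem_product, Prod.exists] at hx
      rcases hx with hx | ⟨g, h, ⟨hg, hh⟩, rfl⟩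
      · exact ⟨hK _ (Finset.mem_filter.1 hx).1, (Finset.mem_filter.1 hx).2⟩
      · obtain ⟨hgT, hg⟩ := Finset.mem_filter.1 hg
        obtain ⟨hhT, hh⟩ := Finset.mem_filter.1 hh
        refine ⟨?_, by simp [mul_comm]⟩
        rw [sub_eq_add_neg, ← neg_smul]
        exact add_mem (K.smul_mem hg.le (hK _ hhT)) (K.smul_mem (neg_nonneg.2 hh) (hK _ hgT))
    | zero => simp
    | add x y _ _ hx hy => exact ⟨add_mem hx.1 hy.1, by rw [map_add]; linarith [hx.2, hy.2]⟩
    | smul r x _ hx =>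
      refine ⟨K.smul_mem r.2 hx.1, ?_⟩
      rw [show r • x = (r : ℝ) • x from rfl, map_smul, smul_eq_mul]
      exact mul_nonpos_of_nonneg_of_nonpos r.2 hx.2
  · rintro ⟨hx, hax⟩
    have hsplit : K = PointedCone.hull ℝ (Tp : Set V) ⊔ PointedCone.hull ℝ (Tm : Set V) := by
      rw [PointedCone.hull, PointedCone.hull, ← Submodule.span_union, ← Finset.coe_union]
      have : Tp ∪ Tm = T := by
        ext g
        simp only [hTp, hTm, Finset.mem_union, Finset.mem_filter, ← and_or_left, lt_or_ge, and_true]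
      rw [this]
    rw [hsplit] at hx
    obtain ⟨p, hp, m, hmm, rfl⟩ := Submodule.mem_sup.1 hx
    rw [map_add] at hax
    rcases (hma m hmm).lt_or_eq with h | h
    · -- `p + m = (1 - s) m + (p + s m)` with `s = a p / -a m`, which makes `a (p + s m) = 0`.
      have hs : a p / -a m ≤ 1 := by rw [div_le_one (by linarith)]; linarith
      have : p + m = (1 - a p / -a m) • m + (-a m)⁻¹ • (a p • m - a m • p) := by
        match_scalars <;> field_simp [h.ne]
        ring
      rw [this]
      exact add_mem (K'.smul_mem (by linarith) (hm hmm))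
        (K'.smul_mem (inv_nonneg.2 (by linarith)) (hpm p hp m hmm))
    · rw [(hpa p hp).2 (le_antisymm (by linarith) (hpa p hp).1), zero_add]
      exact hm hmm

lemma exists_hull_eq_top [Module.Finite ℝ V] :
    ∃ T : Finset V, ∀ x, x ∈ PointedCone.hull ℝ (T : Set V) := by
  classical
  obtain ⟨S, hS⟩ := Module.Finite.fg_top (R := ℝ) (M := V)
  refine ⟨S ∪ S.image Neg.neg, fun x => ?_⟩
  set K := PointedCone.hull ℝ ((S ∪ S.image Neg.neg : Finset V) : Set V)
  have hx : x ∈ Submodule.span ℝ (S : Set V) := hS ▸ Submodule.mem_top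
  suffices h : x ∈ K ∧ -x ∈ K from h.1
  induction hx using Submodule.span_induction with
  | mem x hx =>
    exact ⟨Submodule.subset_span (by simp_all), Submodule.subset_span (by simp_all)⟩
  | zero => simp
  | add x y _ _ hx hy => exact ⟨add_mem hx.1 hy.1, by rw [neg_add]; exact add_mem hx.2 hy.2⟩
  | smul r x _ hx =>
    rcases le_total 0 r with hr | hr
    · exact ⟨K.smul_mem hr hx.1, by rw [← smul_neg]; exact K.smul_mem hr hx.2⟩
    · refine ⟨?_, by rw [← neg_smul]; exact K.smul_mem (neg_nonneg.2 hr) hx.1⟩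
      rw [← neg_smul_neg]
      exact K.smul_mem (neg_nonneg.2 hr) hx.2

lemma exists_hull_eq_polyhedral_cone [Module.Finite ℝ V] {ι : Type*} [Finite ι]
    (a : ι → V →ₗ[ℝ] ℝ) :
    ∃ T : Finset V, ∀ x, x ∈ PointedCone.hull ℝ (T : Set V) ↔ ∀ i, a i x ≤ 0 := by
  classical
  have := Fintype.ofFinite ι
  have h : ∀ s : Finset ι, ∃ T : Finset V, ∀ x, x ∈ PointedCone.hull ℝ (T : Set V) ↔
      ∀ i ∈ s, a i x ≤ 0 := by
    intro s
    induction s using Finset.induction_on with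
    | empty => simpa using exists_hull_eq_top
    | insert i s _ ih =>
      obtain ⟨T, hT⟩ := ih
      obtain ⟨T', hT'⟩ := exists_hull_eq_inter_halfspace T (a i)
      exact ⟨T', fun x => by rw [hT', hT, Finset.forall_mem_insert, and_comm]⟩
  simpa using h Finset.univ

/-- Every nonempty polyhedron has a V-representation: dehomogenize generators of the cone over it. -/
lemma exists_isVRep [Module.Finite ℝ V] {ι : Type*} [Finite ι] (a : ι → V →ₗ[ℝ] ℝ) (b : ι → ℝ)
    (hne : ∃ y, ∀ i, a i y ≤ b i) :
    ∃ P D : Finset V, IsVRep {y | ∀ i, a i y ≤ b i} P D := by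
  classical
  obtain ⟨T, hT⟩ := exists_hull_eq_polyhedral_cone (V := V × ℝ) (ι := ι ⊕ Unit)
    (Sum.elim (fun i => a i ∘ₗ LinearMap.fst ℝ V ℝ - b i • LinearMap.snd ℝ V ℝ)
      fun _ => -LinearMap.snd ℝ V ℝ)
  have hT' : ∀ y t, (y, t) ∈ PointedCone.hull ℝ (T : Set (V × ℝ)) ↔
      (∀ i, a i y ≤ b i * t) ∧ 0 ≤ t := by
    intro y t
    rw [hT]
    simp [Sum.forall]
  set P := (T.filter fun g => 0 < g.2).image fun g => g.2⁻¹ • g.1 with hP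
  set D := (T.filter fun g => g.2 = 0).image Prod.fst with hD
  have hTt : ∀ g ∈ T, (∀ i, a i g.1 ≤ b i * g.2) ∧ 0 ≤ g.2 := fun g hg =>
    (hT' g.1 g.2).1 (Submodule.subset_span hg)
  have hPmem : ∀ g ∈ T, 0 < g.2 → g.2⁻¹ • g.1 ∈ convexHull ℝ (P : Set V) := fun g hg h =>
    subset_convexHull ℝ _ (by
      simp only [hP, Finset.coe_image, Finset.coe_filter]
      exact ⟨g, ⟨hg, h⟩, rfl⟩)
  have hPne : ∃ p, p ∈ convexHull ℝ (P : Set V) := by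
    by_contra hno
    have h0 : ∀ g ∈ T, g.2 = 0 := fun g hg =>
      ((hTt g hg).2.eq_or_lt.resolve_right fun h => hno ⟨_, hPmem g hg h⟩).symm
    have h0' : ∀ g ∈ PointedCone.hull ℝ (T : Set (V × ℝ)), g.2 = 0 := by
      intro g hg
      induction hg using Submodule.span_induction with
      | mem g hg => exact h0 g hg
      | zero => rfl
      | add g g' _ _ h h' => simp [h, h']
      | smul r g _ h => simp [h]
    obtain ⟨y, hy⟩ := hne
    have := h0' (y, 1) ((hT' y 1).2 ⟨by simpa using hy, zero_le_one⟩)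
    norm_num at this
  obtain ⟨p₀, hp₀⟩ := hPne
  have hrep : ∀ g ∈ PointedCone.hull ℝ (T : Set (V × ℝ)), 0 ≤ g.2 ∧
      ∃ p ∈ convexHull ℝ (P : Set V), ∃ d ∈ PointedCone.hull ℝ (D : Set V), g.1 = g.2 • p + d := by
    intro g hg
    induction hg using Submodule.span_induction with
    | mem g hg =>
      refine ⟨(hTt g hg).2, ?_⟩
      rcases (hTt g hg).2.eq_or_lt with h | h
      · refine ⟨p₀, hp₀, g.1, Submodule.subset_span ?_, by simp [← h]⟩
        simp only [hD, Finset.coe_image, Finset.coe_filter]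
        exact ⟨g, ⟨hg, h.symm⟩, rfl⟩
      · exact ⟨_, hPmem g hg h, 0, zero_mem _, by rw [smul_inv_smul₀ h.ne', add_zero]⟩
    | zero => exact ⟨le_rfl, p₀, hp₀, 0, zero_mem _, by simp⟩
    | add g g' _ _ h h' =>
      obtain ⟨ht, p, hp, d, hd, e⟩ := h
      obtain ⟨ht', p', hp', d', hd', e'⟩ := h'
      refine ⟨add_nonneg ht ht', ?_⟩
      rcases (add_nonneg ht ht').eq_or_lt with h0 | h0
      · have h1 : g.2 = 0 := by linarith
        have h2 : g'.2 = 0 := by linarith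
        exact ⟨p₀, hp₀, d + d', add_mem hd hd', by simp [e, e', h1, h2]⟩
      · refine ⟨(g.2 / (g.2 + g'.2)) • p + (g'.2 / (g.2 + g'.2)) • p', ?_, d + d',
          add_mem hd hd', ?_⟩
        · exact convex_convexHull ℝ _ hp hp' (by positivity) (by positivity)
            (by rw [← add_div, div_self h0.ne'])
        · rw [Prod.fst_add, Prod.snd_add, e, e']
          match_scalars <;> field_simp
    | smul r g _ h =>
      obtain ⟨ht, p, hp, d, hd, e⟩ := h
      refine ⟨mul_nonneg r.2 ht, p, hp, r • d, Submodule.smul_mem _ r hd, ?_⟩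
      rw [Prod.smul_fst, Prod.smul_snd, e, smul_add, smul_assoc]
  refine ⟨P, D, Set.Subset.antisymm (fun y hy => ?_) ?_⟩
  · obtain ⟨-, p, hp, d, hd, e⟩ := hrep (y, 1) ((hT' y 1).2 ⟨by simpa using hy, zero_le_one⟩)
    exact ⟨p, hp, d, hd, by simpa using e.symm⟩
  · rintro _ ⟨p, hp, d, hd, rfl⟩ i
    have h1 : a i p ≤ b i := by
      have hconv : Convex ℝ {y | a i y ≤ b i} := convex_halfSpace_le (a i).isLinear (b i)
      refine convexHull_min ?_ hconv hp
      intro y hy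
      simp only [hP, Finset.coe_image, Finset.coe_filter] at hy
      obtain ⟨g, ⟨hg, h⟩, rfl⟩ := hy
      simp only [Set.mem_ofPred_eq, map_smul, smul_eq_mul]
      rw [inv_mul_le_iff₀ h, mul_comm]
      exact (hTt g hg).1 i
    have h2 : a i d ≤ 0 := by
      refine map_nonpos_of_mem_hull (fun y hy => ?_) hd
      simp only [hD, Finset.coe_image, Finset.coe_filter] at hy
      obtain ⟨g, ⟨hg, h⟩, rfl⟩ := hy
      simpa [h] using (hTt g hg).1 i
    simp only [map_add]
    linarith

end LinearInequalities

/-! ### Minimal systems of outer normals -/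

open Filter Topology

variable {n q : ℕ}

lemma exists_pos_add_smul_mem {A : Set (Euc q)} {y d : Euc q} (h : A ∈ 𝓝 y) :
    ∃ t : ℝ, 0 < t ∧ y + t • d ∈ A := by
  have hcont : Tendsto (fun t : ℝ => y + t • d) (𝓝[>] 0) (𝓝 y) := by
    have : ContinuousAt (fun t : ℝ => y + t • d) 0 := by fun_prop
    simpa using this.tendsto.mono_left nhdsWithin_le_nhds
  obtain ⟨t, ht, ht0⟩ := ((hcont.eventually h).and self_mem_nhdsWithin).exists
  exact ⟨t, ht0, ht⟩

lemma setOf_inner_lt_mem_nhds {N : Finset (Euc q)} {γ : Euc q → ℝ} {y : Euc q}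
    (h : ∀ v ∈ N, inner ℝ v y < γ v) : {z | ∀ v ∈ N, inner ℝ v z < γ v} ∈ 𝓝 y :=
  (eventually_all_finset N).2 fun v hv =>
    (continuous_const.inner continuous_id).continuousAt.eventually_lt continuousAt_const (h v hv)

lemma inner_lt_of_mem_interior {A : Set (Euc q)} {v y : Euc q} {c : ℝ} (hv : ‖v‖ = 1)
    (hA : ∀ z ∈ A, inner ℝ v z ≤ c) (hy : y ∈ interior A) : inner ℝ v y < c := by
  obtain ⟨t, ht, hmem⟩ := exists_pos_add_smul_mem (d := v) (mem_interior_iff_mem_nhds.1 hy)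
  have := hA _ hmem
  rw [inner_add_right, real_inner_smul_right, real_inner_self_eq_norm_sq, hv] at this
  linarith

/-- For a set with nonempty interior, a minimal system of outer normals consists of the facet
normals, and these occur in every system of outer normals. -/
lemma IsMinimalNormalSystem.subset {A : Set (Euc q)} {N N' : Finset (Euc q)}
    (hA : (interior A).Nonempty) (hN : IsMinimalNormalSystem A N) (hN' : IsNormalSystem A N') :
    N ⊆ N' := by
  classical
  obtain ⟨⟨hu, γ, hγ⟩, hmin⟩ := hN
  obtain ⟨hu', γ', hγ'⟩ := hN'
  intro w hw
  obtain ⟨y₁, hy₁⟩ := hA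
  -- By minimality some `y₀` violates the inequality of `w` only.
  obtain ⟨y₀, hy₀, hwy₀⟩ : ∃ y₀, (∀ v ∈ N.erase w, inner ℝ v y₀ ≤ γ v) ∧ γ w < inner ℝ w y₀ := by
    by_contra! hno
    refine (Finset.card_erase_lt_of_mem hw).not_ge (hmin _ ⟨fun v hv => hu v
      (Finset.mem_of_mem_erase hv), γ, ?_⟩)
    rw [hγ]
    ext y
    refine ⟨fun h v hv => h v (Finset.mem_of_mem_erase hv), fun h v hv => ?_⟩
    rcases eq_or_ne v w with rfl | hvw
    · exact hno y h
    · exact h v (Finset.mem_erase.2 ⟨hvw, hv⟩)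
  have hlt : ∀ v ∈ N, inner ℝ v y₁ < γ v := fun v hv =>
    inner_lt_of_mem_interior (hu v hv) (fun z hz => by rw [hγ] at hz; exact hz v hv) hy₁
  -- The segment from `y₁` to `y₀` leaves `A` at a relative interior point `y` of the facet of `w`.
  obtain ⟨y, hyw, hy⟩ : ∃ y, inner ℝ w y = γ w ∧ ∀ v ∈ N.erase w, inner ℝ v y < γ v := by
    have h1 := hlt w hw
    have hpos : 0 < inner ℝ w y₀ - inner ℝ w y₁ := by linarith
    set s := (γ w - inner ℝ w y₁) / (inner ℝ w y₀ - inner ℝ w y₁) with hs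
    have hs0 : 0 < s := div_pos (by linarith) hpos
    have hs1 : s < 1 := by rw [hs, div_lt_one hpos]; linarith
    have hin : ∀ v : Euc q, inner ℝ v ((1 - s) • y₁ + s • y₀) =
        (1 - s) * inner ℝ v y₁ + s * inner ℝ v y₀ := fun v => by
      rw [inner_add_right, real_inner_smul_right, real_inner_smul_right]
    refine ⟨(1 - s) • y₁ + s • y₀, ?_, fun v hv => ?_⟩
    · rw [hin]
      have : s * (inner ℝ w y₀ - inner ℝ w y₁) = γ w - inner ℝ w y₁ := div_mul_cancel₀ _ hpos.ne'
      linarith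
    · rw [hin]
      nlinarith [hlt v (Finset.mem_of_mem_erase hv), hy₀ v hv]
  have hyA : y ∈ A := by
    rw [hγ]
    intro v hv
    rcases eq_or_ne v w with rfl | hvw
    · exact hyw.le
    · exact (hy v (Finset.mem_erase.2 ⟨hvw, hv⟩)).le
  obtain ⟨w', hw', hact⟩ : ∃ w' ∈ N', inner ℝ w' y = γ' w' := by
    by_contra! hno
    have hlt' : ∀ v ∈ N', inner ℝ v y < γ' v := fun v hv =>
      lt_of_le_of_ne (by rw [hγ'] at hyA; exact hyA v hv) (hno v hv)
    have hnhds : A ∈ 𝓝 y := by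
      refine mem_of_superset (setOf_inner_lt_mem_nhds hlt') fun z hz => ?_
      rw [hγ']
      exact fun v hv => (hz v hv).le
    obtain ⟨t, ht, hmem⟩ := exists_pos_add_smul_mem (d := w) hnhds
    rw [hγ] at hmem
    have := hmem w hw
    rw [inner_add_right, real_inner_smul_right, real_inner_self_eq_norm_sq, hu w hw, hyw] at this
    linarith
  -- Near `y` the set `A` is the half-space of `w`, so the half-space of `w'` contains that of `w`.
  have hhalf : ∀ d : Euc q, inner ℝ w d ≤ 0 → inner ℝ w' d ≤ 0 := by
    intro d hd
    obtain ⟨t, ht, hmem⟩ := exists_pos_add_smul_mem (d := d) (setOf_inner_lt_mem_nhds hy)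
    have hmemA : y + t • d ∈ A := by
      rw [hγ]
      intro v hv
      rcases eq_or_ne v w with rfl | hvw
      · rw [inner_add_right, real_inner_smul_right, hyw]
        nlinarith
      · exact (hmem v (Finset.mem_erase.2 ⟨hvw, hv⟩)).le
    rw [hγ'] at hmemA
    have := hmemA w' hw'
    rw [inner_add_right, real_inner_smul_right, hact] at this
    nlinarith
  have hww : inner ℝ w w = 1 := by rw [real_inner_self_eq_norm_sq, hu w hw, one_pow]
  have hww' : inner ℝ w' w' = 1 := by rw [real_inner_self_eq_norm_sq, hu' w' hw', one_pow]
  have h1 := hhalf (-w) (by rw [inner_neg_right, hww]; norm_num)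
  have h2 := hhalf (w' - (inner ℝ w w' : ℝ) • w) (by
    rw [inner_sub_right, real_inner_smul_right, hww]; linarith)
  rw [inner_neg_right, real_inner_comm] at h1
  rw [inner_sub_right, real_inner_smul_right, hww', real_inner_comm w w'] at h2
  have h3 := real_inner_le_norm w w'
  rw [hu w hw, hu' w' hw'] at h3
  have h4 : inner ℝ w w' = 1 := by nlinarith
  rwa [(inner_eq_one_iff_of_norm_eq_one (hu w hw) (hu' w' hw')).1 h4]

lemma IsNormalSystem.exists_minimal {A : Set (Euc q)} {N : Finset (Euc q)}
    (h : IsNormalSystem A N) : ∃ N', IsMinimalNormalSystem A N' := by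
  obtain ⟨N', hN', hmin⟩ := (measure (Finset.card (α := Euc q))).wf.has_min
    {N | IsNormalSystem A N} ⟨N, h⟩
  exact ⟨N', hN', fun N'' h'' => not_lt.1 (hmin N'' h'')⟩

/-- The Riesz representative of a linear functional, scaled to norm one; it is `0` for the zero
functional. -/
noncomputable def unitNormal (f : Euc q →ₗ[ℝ] ℝ) : Euc q :=
  let a := (InnerProductSpace.toDual ℝ (Euc q)).symm (LinearMap.toContinuousLinearMap f)
  ‖a‖⁻¹ • a

lemma norm_unitNormal {f : Euc q →ₗ[ℝ] ℝ} (hf : f ≠ 0) : ‖unitNormal f‖ = 1 := by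
  have : (InnerProductSpace.toDual ℝ (Euc q)).symm (LinearMap.toContinuousLinearMap f) ≠ 0 := by
    simpa using hf
  rw [unitNormal, norm_smul, norm_inv, norm_norm, inv_mul_cancel₀ (norm_ne_zero_iff.2 this)]

lemma exists_mul_inner_unitNormal {f : Euc q →ₗ[ℝ] ℝ} (hf : f ≠ 0) :
    ∃ r : ℝ, 0 < r ∧ ∀ y, f y = r * inner ℝ (unitNormal f) y := by
  have : (InnerProductSpace.toDual ℝ (Euc q)).symm (LinearMap.toContinuousLinearMap f) ≠ 0 := by
    simpa using hf
  refine ⟨_, norm_pos_iff.2 this, fun y => ?_⟩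
  rw [unitNormal, real_inner_smul_left, mul_inv_cancel_left₀ (norm_ne_zero_iff.2 this),
    InnerProductSpace.toDual_symm_apply]
  rfl

/-- The unit normals of the nonzero functionals of a finite family. -/
noncomputable def unitNormals {ι : Type*} [Finite ι] (f : ι → Euc q →ₗ[ℝ] ℝ) : Finset (Euc q) :=
  ((Set.toFinite {i | f i ≠ 0}).image fun i => unitNormal (f i)).toFinset

lemma isNormalSystem_unitNormals {ι : Type*} [Finite ι] (f : ι → Euc q →ₗ[ℝ] ℝ) (β : ι → ℝ)
    {A : Set (Euc q)} (hA : ∀ y, y ∈ A ↔ ∀ i, f i y ≤ β i) (hne : A.Nonempty) :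
    IsNormalSystem A (unitNormals f) := by
  have hmem : ∀ w, w ∈ unitNormals f ↔ ∃ i, f i ≠ 0 ∧ unitNormal (f i) = w := fun w => by
    simp [unitNormals]
  refine ⟨fun w hw => ?_, fun w => sSup (inner ℝ w '' A), Set.Subset.antisymm ?_ ?_⟩
  · obtain ⟨i, hi, rfl⟩ := (hmem w).1 hw
    exact norm_unitNormal hi
  · intro y hy w hw
    obtain ⟨i, hi, rfl⟩ := (hmem w).1 hw
    obtain ⟨r, hr, hf⟩ := exists_mul_inner_unitNormal hi
    refine le_csSup ⟨β i / r, ?_⟩ ⟨y, hy, rfl⟩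
    rintro _ ⟨z, hz, rfl⟩
    rw [le_div_iff₀' hr, ← hf]
    exact (hA z).1 hz i
  · intro y hy
    refine (hA y).2 fun i => ?_
    by_cases hi : f i = 0
    · obtain ⟨z, hz⟩ := hne
      simpa [hi] using (hA z).1 hz i
    · obtain ⟨r, hr, hf⟩ := exists_mul_inner_unitNormal hi
      rw [hf, ← le_div_iff₀' hr]
      refine (hy _ ((hmem _).2 ⟨i, hi, rfl⟩)).trans (csSup_le (hne.image _) ?_)
      rintro _ ⟨z, hz, rfl⟩
      rw [le_div_iff₀' hr, ← hf]
      exact (hA z).1 hz i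

/-! ### Inequality systems for `F + C` and its recession mapping -/

variable {F G H : Euc n → Set (Euc q)} {C : PointedCone ℝ (Euc q)}

lemma nonpos_of_forall_add_nat_mul_le {α β γ : ℝ} (h : ∀ k : ℕ, α + k * β ≤ γ) : β ≤ 0 := by
  by_contra! hβ
  obtain ⟨k, hk⟩ := exists_nat_gt ((γ - α) / β)
  rw [div_lt_iff₀ hβ] at hk
  linarith [h k]

lemma mem_recCone_iff {V ι : Type*} [AddCommGroup V] [Module ℝ V] {A : Set V}
    {a : ι → V →ₗ[ℝ] ℝ} {b : ι → ℝ} (hA : ∀ x, x ∈ A ↔ ∀ i, a i x ≤ b i) (hne : A.Nonempty)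
    (v : V) : v ∈ recCone A ↔ ∀ i, a i v ≤ 0 := by
  constructor
  · intro hv i
    obtain ⟨x, hx⟩ := hne
    refine nonpos_of_forall_add_nat_mul_le (α := a i x) (γ := b i) fun k => ?_
    simpa using (hA _).1 (hv x hx k k.cast_nonneg) i
  · intro hv x hx t ht
    refine (hA _).2 fun i => ?_
    rw [map_add, map_smul, smul_eq_mul]
    nlinarith [(hA x).1 hx i, hv i]

lemma exists_cone_inequalities (hC : IsPolyhedron (C : Set (Euc q))) :
    ∃ (m : ℕ) (h : Fin m → Euc q →ₗ[ℝ] ℝ), ∀ y, y ∈ C ↔ ∀ j, h j y ≤ 0 := by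
  obtain ⟨m, h, β, hβ⟩ := hC
  have hmem : ∀ y, y ∈ C ↔ ∀ j, h j y ≤ β j := fun y => by
    rw [← SetLike.mem_coe, hβ]; rfl
  refine ⟨m, h, fun y => ⟨fun hy j => ?_, fun hy => (hmem y).2 fun j => (hy j).trans ?_⟩⟩
  · refine nonpos_of_forall_add_nat_mul_le (α := 0) (γ := β j) fun k => ?_
    simpa using (hmem _).1 (C.smul_mem (Nat.cast_nonneg (α := ℝ) k) hy) j
  · simpa using (hmem 0).1 C.zero_mem j

lemma mem_add_iff {S : Set (Euc q)} {y : Euc q} :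
    y ∈ S + (C : Set (Euc q)) ↔ ∃ u ∈ S, y - u ∈ C := by
  constructor
  · rintro ⟨u, hu, c, hc, rfl⟩
    exact ⟨u, hu, by simpa using hc⟩
  · rintro ⟨u, hu, hc⟩
    exact ⟨u, hu, _, hc, add_sub_cancel u y⟩

lemma add_mem_add_of_mem {S : Set (Euc q)} {y c : Euc q} (hy : y ∈ S + (C : Set (Euc q)))
    (hc : c ∈ C) : y + c ∈ S + (C : Set (Euc q)) := by
  obtain ⟨u, hu, c', hc', rfl⟩ := hy
  exact ⟨u, hu, c' + c, add_mem hc' hc, (add_assoc u c' c).symm⟩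

lemma mem_upperImage {y : Euc q} : y ∈ upperImage F C ↔ ∃ x, y ∈ F x + (C : Set (Euc q)) := by
  rw [upperImage, add_comm, Set.iUnion_add, Set.mem_iUnion]

/-- The inequalities `B i x + A i y ≤ b i` describe the graph of `H + C`, and their homogeneous
version describes the graph of `G + C`. For `b = 0` this covers the pair `(G, G)`. -/
structure IsSystem {ι : Type} (H G : Euc n → Set (Euc q)) (C : PointedCone ℝ (Euc q))
    (B : ι → Euc n →ₗ[ℝ] ℝ) (A : ι → Euc q →ₗ[ℝ] ℝ) (b : ι → ℝ) : Prop where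
  mem_iff : ∀ x y, y ∈ H x + (C : Set (Euc q)) ↔ ∀ i, B i x + A i y ≤ b i
  mem_rec_iff : ∀ x y, y ∈ G x + (C : Set (Euc q)) ↔ ∀ i, B i x + A i y ≤ 0

/-- Eliminating the summand in `F x` from the inequalities for `graph F` and `C` describes `F + C`;
the same elimination with zero right-hand side describes `recMap F + C`. -/
lemma exists_isSystem (hF : IsPolyhedron (graph F)) (hC : IsPolyhedron (C : Set (Euc q)))
    (hne : (graph F).Nonempty) :
    ∃ (ι : Type) (_ : Finite ι) (B : ι → Euc n →ₗ[ℝ] ℝ) (A : ι → Euc q →ₗ[ℝ] ℝ) (b : ι → ℝ),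
      IsSystem F (recMap F) C B A b := by
  obtain ⟨m, a, b, hab⟩ := hF
  obtain ⟨m', h, hh⟩ := exists_cone_inequalities hC
  have hgr : ∀ p, p ∈ graph F ↔ ∀ i, a i p ≤ b i := fun p => by rw [hab]; rfl
  obtain ⟨κ, hκ, L, hL⟩ := eliminable_of_finite (W := Euc q) (Fin m ⊕ Fin m')
    (Sum.elim (fun i => a i ∘ₗ LinearMap.inr ℝ _ _) fun j => -h j)
  set X : Euc n →ₗ[ℝ] (Fin m ⊕ Fin m' → ℝ) := LinearMap.pi
    (Sum.elim (fun i => a i ∘ₗ LinearMap.inl ℝ _ _) fun _ => 0) with hX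
  set Y : Euc q →ₗ[ℝ] (Fin m ⊕ Fin m' → ℝ) := LinearMap.pi (Sum.elim (fun _ => 0) h) with hY
  have key : ∀ (β : Fin m → ℝ) (x : Euc n) (y : Euc q),
      (∃ u, (∀ i, a i (x, u) ≤ β i) ∧ y - u ∈ C) ↔
        ∀ k, (L k ∘ₗ X) x + (L k ∘ₗ Y) y ≤ L k (Sum.elim β 0) := by
    intro β x y
    have hsplit : ∀ i u, a i (x, u) = a i (x, 0) + a i (0, u) := fun i u => by
      rw [← map_add, Prod.mk_add_mk, add_zero, zero_add]
    have e := hL (Sum.elim β 0 - X x - Y y)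
    simp only [sub_sub, map_sub, map_add, sub_nonneg] at e
    refine Iff.trans (exists_congr fun u => ?_) e
    rw [Sum.forall, hh]
    refine and_congr (forall_congr' fun i => ?_) (forall_congr' fun j => ?_)
    · simp [hX, hY, hsplit i u, le_sub_iff_add_le']
    · simp [hX, hY]
  refine ⟨κ, hκ, fun k => L k ∘ₗ X, fun k => L k ∘ₗ Y, fun k => L k (Sum.elim b 0),
    fun x y => ?_, fun x y => ?_⟩
  · rw [mem_add_iff, ← key]
    exact exists_congr fun u => and_congr_left' (hgr (x, u))
  · rw [mem_add_iff]
    have h0 : ∀ k, L k (Sum.elim (0 : Fin m → ℝ) 0) = 0 := fun k => by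
      rw [show (Sum.elim (0 : Fin m → ℝ) (0 : Fin m' → ℝ)) = 0 by ext (i | i) <;> rfl, map_zero]
    have := key 0 x y
    simp only [h0] at this
    rw [← this]
    exact exists_congr fun u => and_congr_left' (mem_recCone_iff hgr hne (x, u))

namespace IsSystem

variable {ι : Type} {B : ι → Euc n →ₗ[ℝ] ℝ} {A : ι → Euc q →ₗ[ℝ] ℝ} {b : ι → ℝ}

lemma recession (h : IsSystem H G C B A b) : IsSystem G G C B A 0 :=
  ⟨h.mem_rec_iff, h.mem_rec_iff⟩

lemma add_mem (h : IsSystem H G C B A b) {x d : Euc n} {y v : Euc q}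
    (hy : y ∈ H x + (C : Set (Euc q))) (hv : v ∈ G d + (C : Set (Euc q))) :
    y + v ∈ H (x + d) + (C : Set (Euc q)) := by
  refine (h.mem_iff _ _).2 fun i => ?_
  rw [map_add, map_add]
  linarith [(h.mem_iff _ _).1 hy i, (h.mem_rec_iff _ _).1 hv i]

lemma mem_rec_zero_of_forall (h : IsSystem H G C B A b) {x : Euc n} {y v : Euc q}
    (hv : ∀ k : ℕ, y + (k : ℝ) • v ∈ H x + (C : Set (Euc q))) :
    v ∈ G 0 + (C : Set (Euc q)) := by
  refine (h.mem_rec_iff _ _).2 fun i => ?_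
  rw [map_zero, zero_add]
  refine nonpos_of_forall_add_nat_mul_le (α := B i x + A i y) (γ := b i) fun k => ?_
  have := (h.mem_iff _ _).1 (hv k) i
  rw [map_add, map_smul, smul_eq_mul] at this
  linarith

lemma exists_isMinimalNormalSystem [Finite ι] (h : IsSystem H G C B A b) {x : Euc n}
    (hx : (H x + (C : Set (Euc q))).Nonempty) :
    ∃ N, IsMinimalNormalSystem (H x + (C : Set (Euc q))) N :=
  (isNormalSystem_unitNormals A (fun i => b i - B i x)
    (fun y => by simp only [h.mem_iff, le_sub_iff_add_le']) hx).exists_minimal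

/-- All normals that can occur come from one finite set: the values of `H + C` are full-dimensional
and differ in the right-hand sides only. -/
lemma minimalNormalSystem_subset [Finite ι] (h : IsSystem H G C B A b)
    (hint : (interior (C : Set (Euc q))).Nonempty) {x : Euc n}
    (hx : (H x + (C : Set (Euc q))).Nonempty) {N : Finset (Euc q)}
    (hN : IsMinimalNormalSystem (H x + (C : Set (Euc q))) N) : N ⊆ unitNormals A := by
  refine hN.subset ?_ (isNormalSystem_unitNormals A (fun i => b i - B i x)
    (fun y => by simp only [h.mem_iff, le_sub_iff_add_le']) hx)
  obtain ⟨u, hu⟩ : (H x).Nonempty := hx.of_add_left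
  obtain ⟨c, hc⟩ := hint
  have hsub : ({u} : Set (Euc q)) + interior (C : Set (Euc q)) ⊆ H x + (C : Set (Euc q)) :=
    Set.add_subset_add (Set.singleton_subset_iff.2 hu) interior_subset
  exact ⟨u + c, interior_maximal hsub isOpen_interior.add_left ⟨u, rfl, c, hc, rfl⟩⟩

/-- The upper image is a polyhedron, and its recession directions lie in values of `G + C`. -/
lemma exists_upperImage_inequalities [Finite ι] (h : IsSystem H G C B A b) :
    ∃ (κ : Type) (_ : Finite κ) (a : κ → Euc q →ₗ[ℝ] ℝ) (β : κ → ℝ),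
      (∀ y, y ∈ upperImage H C ↔ ∀ k, a k y ≤ β k) ∧
        ∀ v, (∃ x, v ∈ G x + (C : Set (Euc q))) ↔ ∀ k, a k v ≤ 0 := by
  obtain ⟨κ, hκ, L, hL⟩ := eliminable_of_finite (W := Euc n) ι B
  have key : ∀ (β : ι → ℝ) (y : Euc q), (∃ x, ∀ i, B i x + A i y ≤ β i) ↔
      ∀ k, (L k ∘ₗ LinearMap.pi A) y ≤ L k β := by
    intro β y
    have e := hL (β - LinearMap.pi A y)
    simp only [map_sub, sub_nonneg] at e
    refine Iff.trans (exists_congr fun x => forall_congr' fun i => ?_) e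
    exact le_sub_iff_add_le.symm
  refine ⟨κ, hκ, fun k => L k ∘ₗ LinearMap.pi A, fun k => L k b, fun y => ?_, fun v => ?_⟩
  · rw [mem_upperImage, ← key]
    exact exists_congr fun x => h.mem_iff x y
  · have := key 0 v
    simp only [map_zero] at this
    rw [← this]
    exact exists_congr fun x => h.mem_rec_iff x v

lemma exists_isVRep_upperImage [Finite ι] (h : IsSystem H G C B A b)
    (hne : (upperImage H C).Nonempty) : ∃ P D, IsVRep (upperImage H C) P D := by
  obtain ⟨κ, _, a, β, hmem, -⟩ := h.exists_upperImage_inequalities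
  rw [show upperImage H C = {y | ∀ k, a k y ≤ β k} from Set.ext hmem]
  exact exists_isVRep a β (hne.imp fun y hy => (hmem y).1 hy)

lemma exists_mem_rec_of_isVRep [Finite ι] (h : IsSystem H G C B A b)
    (hne : (upperImage H C).Nonempty) {P D : Finset (Euc q)} (hPD : IsVRep (upperImage H C) P D)
    {v : Euc q} (hv : v ∈ D) : ∃ x, v ∈ G x + (C : Set (Euc q)) := by
  obtain ⟨κ, _, a, β, hmem, hrec⟩ := h.exists_upperImage_inequalities
  refine (hrec v).2 ((mem_recCone_iff hmem hne v).1 fun y hy t ht => ?_)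
  unfold IsVRep at hPD
  rw [hPD] at hy ⊢
  obtain ⟨p, hp, d, hd, rfl⟩ := hy
  exact ⟨p, hp, d + t • v, Submodule.add_mem _ hd
    (PointedCone.smul_mem _ ht (Submodule.subset_span hv)), (add_assoc p d _).symm⟩

/-! ### Minimizers and the linear programs -/

/-- If some `G d + C` were larger than `C`, adding `d` to `x` would enlarge `H x + C`, unless
`H x + C` absorbs a direction outside `C`. So a single minimizer forces `0` to minimize `G`. -/
lemma isMinimizer_rec_zero (h : IsSystem H G C B A b) (hG0 : G 0 = (C : Set (Euc q))) {x : Euc n}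
    (hx : IsMinimizer H C x) : IsMinimizer G C 0 := by
  have h0 : (0 : Euc q) ∈ G 0 := by rw [hG0]; exact C.zero_mem
  refine ⟨⟨0, h0⟩, ?_⟩
  rintro ⟨d, hsub, hnot⟩
  have hmem0 : (0 : Euc q) ∈ G d + (C : Set (Euc q)) := hsub ⟨0, h0, 0, C.zero_mem, add_zero 0⟩
  have hle : H (x + d) + (C : Set (Euc q)) ⊆ H x + (C : Set (Euc q)) := by
    by_contra hno
    exact hx.2 ⟨x + d, fun y hy => by simpa using h.add_mem hy hmem0, hno⟩
  refine hnot fun v hv => ?_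
  obtain ⟨y, hy⟩ := hx.1
  refine h.mem_rec_zero_of_forall (x := x) (y := y) fun k => ?_
  induction k with
  | zero =>
    rw [Nat.cast_zero, zero_smul, add_zero]
    exact ⟨y, hy, 0, C.zero_mem, add_zero y⟩
  | succ k ih =>
    rw [Nat.cast_succ, add_smul, one_smul, ← add_assoc]
    exact hle (h.add_mem ih hv)

/-- If `0` minimizes `G`, the linear programs are solvable: a direction along which the objective
increases would give a value of `G + C` that contains `C` properly. -/
lemma exists_lpOptimal [Finite ι] (h : IsSystem H G C B A b) (hG0 : G 0 = (C : Set (Euc q)))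
    (hmin : IsMinimizer G C 0) {w : Euc q} {γ : ℝ} {x : Euc n}
    (hne : (H x + (C : Set (Euc q))).Nonempty)
    (hw : ∀ y ∈ H x + (C : Set (Euc q)), inner ℝ w y ≤ γ) :
    ∃ xs ys, LPOptimal H C w x xs ys := by
  set S := H x + (C : Set (Euc q)) with hS
  have hbdd : ∀ i, BddAbove (A i '' S) := fun i => by
    refine ⟨b i - B i x, ?_⟩
    rintro _ ⟨y, hy, rfl⟩
    linarith [(h.mem_iff _ _).1 hy i]
  -- Since `S` enters through the suprema of the `A i` only, the feasible set is a polyhedron.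
  have hfeas : ∀ p : Euc n × Euc q, LPFeasible H C x p.1 p.2 ↔ ∀ s,
      Sum.elim (fun i => B i ∘ₗ LinearMap.fst ℝ _ _ + A i ∘ₗ LinearMap.snd ℝ _ _)
        (fun i => B i ∘ₗ LinearMap.fst ℝ _ _) s p ≤
      Sum.elim b (fun i => b i - sSup (A i '' S)) s := by
    intro p
    rw [Sum.forall]
    refine and_congr (h.mem_iff p.1 p.2) ⟨fun hsub i => ?_, fun hp y hy => ?_⟩
    · have : sSup (A i '' S) ≤ b i - B i p.1 := by
        refine csSup_le (hne.image _) ?_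
        rintro _ ⟨y, hy, rfl⟩
        linarith [(h.mem_iff _ _).1 (hsub hy) i]
      simp only [Sum.elim_inr, LinearMap.comp_apply, LinearMap.fst_apply]
      linarith
    · refine (h.mem_iff _ _).2 fun i => ?_
      have h1 := hp i
      have h2 := le_csSup (hbdd i) ⟨y, hy, rfl⟩
      simp only [Sum.elim_inr, LinearMap.comp_apply, LinearMap.fst_apply] at h1
      linarith
  obtain ⟨y₀, hy₀⟩ := hne
  rcases exists_optimal_or_direction _ _ ((innerₗ (Euc q) w) ∘ₗ LinearMap.snd ℝ (Euc n) (Euc q))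
      ⟨(x, y₀), (hfeas (x, y₀)).1 ⟨hy₀, subset_rfl⟩⟩ with ⟨p, hp, hopt⟩ | ⟨⟨d, v⟩, hd, hpos⟩
  · exact ⟨p.1, p.2, (hfeas p).2 hp, fun x' y' h' => hopt (x', y') ((hfeas (x', y')).1 h')⟩
  · exfalso
    rw [Sum.forall] at hd
    have hv : v ∈ G d + (C : Set (Euc q)) := (h.mem_rec_iff _ _).2 fun i => by simpa using hd.1 i
    have h0 : (0 : Euc q) ∈ G d + (C : Set (Euc q)) :=
      (h.mem_rec_iff _ _).2 fun i => by simpa using hd.2 i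
    have hC : G 0 + (C : Set (Euc q)) = C := by
      rw [hG0]
      exact Set.Subset.antisymm (by rintro _ ⟨a, ha, c, hc, rfl⟩; exact Submodule.add_mem C ha hc)
        fun c hc => ⟨c, hc, 0, C.zero_mem, add_zero c⟩
    refine hmin.2 ⟨d, ?_, fun hsub => ?_⟩
    · rw [hC]
      exact fun c hc => by simpa using add_mem_add_of_mem h0 hc
    · -- `w` is nonpositive on `C` because it is bounded above on `S`.
      have hvC : v ∈ C := by simpa [hC] using hsub hv
      have : inner ℝ w v ≤ 0 := by
        refine nonpos_of_forall_add_nat_mul_le (α := inner ℝ w y₀) (γ := γ) fun k => ?_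
        have := hw _ (add_mem_add_of_mem hy₀ (C.smul_mem (Nat.cast_nonneg (α := ℝ) k) hvC))
        rwa [inner_add_right, real_inner_smul_right] at this
      exact absurd hpos (not_lt.2 this)

end IsSystem

/-! ### Total correctness of nondeterministic programs -/

/-- Every run of the transition relation `r` from the given configuration is finite and ends in a
configuration without successor that satisfies `Q`. -/
inductive Terminates {α : Type*} (r : α → α → Prop) (Q : α → Prop) : α → Prop
  | halt (s : α) (hs : ∀ s', ¬ r s s') (hQ : Q s) : Terminates r Q s
  | step (s : α) (hex : ∃ s', r s s') (h : ∀ s', r s s' → Terminates r Q s') : Terminates r Q s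

namespace Terminates

variable {α β : Type*} {r : α → α → Prop} {Q : α → Prop} {s : α}

lemma not_exists_infinite (h : Terminates r Q s) :
    ¬ ∃ f : ℕ → α, f 0 = s ∧ ∀ k, r (f k) (f (k + 1)) := by
  induction h with
  | halt s hs _ => rintro ⟨f, rfl, hf⟩; exact hs _ (hf 0)
  | step s _ _ ih =>
    rintro ⟨f, rfl, hf⟩
    exact ih _ (hf 0) ⟨fun k => f (k + 1), rfl, fun k => hf (k + 1)⟩

lemma of_reflTransGen (h : Terminates r Q s) {t : α} (hst : Relation.ReflTransGen r s t) :
    Terminates r Q t := by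
  induction hst with
  | refl => exact h
  | tail _ hr ih =>
    cases ih with
    | halt _ hs _ => exact absurd hr (hs _)
    | step _ _ h => exact h _ hr

lemma post_or_exists_step (h : Terminates r Q s) : Q s ∨ ∃ s', r s s' := by
  cases h with
  | halt _ _ hQ => exact Or.inl hQ
  | step _ hex _ => exact Or.inr hex

/-- A subprogram embedded by `f` into a larger program: if the subprogram terminates with `Q`, and
the larger program terminates from every embedded configuration satisfying `Q`, then it terminates
from the embedded start. -/
lemma embed {r' : β → β → Prop} {Q' : β → Prop} (f : α → β) (h : Terminates r Q s)
    (hstep : ∀ c c', r c c' → r' (f c) (f c'))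
    (hlift : ∀ c s', (∃ c', r c c') → r' (f c) s' → ∃ c', r c c' ∧ s' = f c')
    (hpost : ∀ c, Q c → Terminates r' Q' (f c)) : Terminates r' Q' (f s) := by
  induction h with
  | halt s _ hQ => exact hpost s hQ
  | step s hex _ ih =>
    refine step _ (hex.imp' f fun c' => hstep s c') fun s' hs' => ?_
    obtain ⟨c', hc', rfl⟩ := hlift s s' hex hs'
    exact ih c' hc'

end Terminates

/-! ### Correctness of `ComputeMinimizer` -/

/-- The intended results of `ComputeMinimizer (H, C, ȳ)`: the empty set if `0` does not minimize the
recession mapping `G`, and otherwise a minimizer of `H` whose value contains `ȳ`. -/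
def IsCorrectReturn (H G : Euc n → Set (Euc q)) (C : PointedCone ℝ (Euc q)) (ybar : Euc q)
    (c : CMState n q) : Prop :=
  (c = .returned ∅ ∧ ¬ IsMinimizer G C 0) ∨
    ∃ x, c = .returned {x} ∧ IsMinimizer H C x ∧ IsMinimizer G C 0 ∧
      ybar ∈ H x + (C : Set (Euc q))

/-- The loop invariant on `W`: in each treated direction `w`, the value at `x` already attains the
maximum of all values that contain it. -/
def IsSaturated (H : Euc n → Set (Euc q)) (C : PointedCone ℝ (Euc q)) (x : Euc n)
    (W : Set (Euc q)) : Prop :=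
  ∀ w ∈ W, ∃ y ∈ H x + (C : Set (Euc q)), ∀ x' y', LPFeasible H C x x' y' →
    inner ℝ w y' ≤ inner ℝ w y

lemma IsSaturated.insert {x xs : Euc n} {ys w : Euc q} {W : Set (Euc q)}
    (hW : IsSaturated H C x W) (hsub : H x + (C : Set (Euc q)) ⊆ H xs + (C : Set (Euc q)))
    (hLP : ∀ x' y', LPFeasible H C x x' y' → inner ℝ w y' ≤ inner ℝ w ys)
    (hys : ys ∈ H xs + (C : Set (Euc q))) : IsSaturated H C xs (Insert.insert w W) := by
  rintro v (rfl | hv)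
  · exact ⟨ys, hys, fun x' y' h => hLP x' y' ⟨h.1, hsub.trans h.2⟩⟩
  · obtain ⟨y, hy, hmax⟩ := hW v hv
    exact ⟨y, hsub hy, fun x' y' h => hmax x' y' ⟨h.1, hsub.trans h.2⟩⟩

/-- A value that is saturated in all of its normal directions cannot be enlarged. -/
lemma IsSaturated.isMinimizer {x : Euc n} {N : Finset (Euc q)} {W : Set (Euc q)}
    (hx : (H x + (C : Set (Euc q))).Nonempty) (hN : IsNormalSystem (H x + (C : Set (Euc q))) N)
    (hW : IsSaturated H C x W) (hNW : (N : Set (Euc q)) ⊆ W) : IsMinimizer H C x := by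
  refine ⟨hx.of_add_left, ?_⟩
  rintro ⟨x', hsub, hnot⟩
  obtain ⟨-, γ, hγ⟩ := hN
  refine hnot fun y' hy' => ?_
  have hmem : ∀ y, y ∈ H x + (C : Set (Euc q)) ↔ ∀ w ∈ N, inner ℝ w y ≤ γ w := fun y => by
    rw [hγ]; rfl
  refine (hmem y').2 fun w hw => ?_
  obtain ⟨y, hy, hmax⟩ := hW w (hNW hw)
  exact (hmax x' y' ⟨hy', hsub⟩).trans ((hmem y).1 hy w hw)

lemma terminates_returned {ybar : Euc q} {S : Set (Euc n)}
    (h : IsCorrectReturn H G C ybar (.returned S)) :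
    Terminates (CMStep H C ybar) (IsCorrectReturn H G C ybar) (.returned S) :=
  .halt _ (fun _ h => nomatch h) h

namespace IsSystem

variable {ι : Type} [Finite ι] {B : ι → Euc n →ₗ[ℝ] ℝ} {A : ι → Euc q →ₗ[ℝ] ℝ} {b : ι → ℝ}

/-- The loop ends because `W` grows within the finite set `unitNormals A`. -/
lemma terminates_loop (h : IsSystem H G C B A b) (hG0 : G 0 = (C : Set (Euc q)))
    (hint : (interior (C : Set (Euc q))).Nonempty) (ybar : Euc q) (x : Euc n)
    (N : Finset (Euc q)) (W : Set (Euc q)) (hy : ybar ∈ H x + (C : Set (Euc q)))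
    (hN : IsMinimalNormalSystem (H x + (C : Set (Euc q))) N) (hW : IsSaturated H C x W) :
    Terminates (CMStep H C ybar) (IsCorrectReturn H G C ybar) (.loop x N W) := by
  induction hk : ((unitNormals A : Set (Euc q)) \ W).ncard using Nat.strong_induction_on
    generalizing x N W with
  | _ k ih =>
    have hlt : ∀ w ∈ N, w ∉ W →
        ((unitNormals A : Set (Euc q)) \ Insert.insert w W).ncard < k := fun w hw hwW => by
      have hwA : w ∈ unitNormals A := h.minimalNormalSystem_subset hint ⟨_, hy⟩ hN hw
      rw [← hk]
      refine Set.ncard_lt_ncard ⟨Set.sdiff_subset_sdiff_right (Set.subset_insert w W), fun hsub => ?_⟩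
        (unitNormals A).finite_toSet.sdiff
      exact (hsub ⟨hwA, hwW⟩).2 (Set.mem_insert w W)
    refine .step _ ?_ fun s' hs' => ?_
    · by_cases hNW : (N : Set (Euc q)) ⊆ W
      · exact ⟨_, .exit x N W hNW⟩
      obtain ⟨w, hw, hwW⟩ := Set.not_subset.1 hNW
      by_cases hLP : ∃ xs ys, LPOptimal H C w x xs ys
      · obtain ⟨xs, ys, hLP⟩ := hLP
        by_cases hys : ys ∈ H x + (C : Set (Euc q))
        · exact ⟨_, .keep x N W w hw hwW xs ys hLP hys⟩
        · obtain ⟨N', hN'⟩ := h.exists_isMinimalNormalSystem ⟨ys, hLP.1.1⟩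
          exact ⟨_, .update x N W w hw hwW xs ys hLP hys N' hN'⟩
      · exact ⟨_, .fail x N W w hw hwW hLP⟩
    · cases hs' with
      | exit _ _ _ hNW =>
        have hx := hW.isMinimizer ⟨_, hy⟩ hN.1 hNW
        exact terminates_returned
          (Or.inr ⟨x, rfl, hx, h.isMinimizer_rec_zero hG0 hx, hy⟩)
      | fail _ _ _ w hw hwW hLP =>
        refine terminates_returned (Or.inl ⟨rfl, fun hmin => hLP ?_⟩)
        obtain ⟨-, γ, hγ⟩ := hN.1
        refine h.exists_lpOptimal hG0 hmin (γ := γ w) ⟨_, hy⟩ fun y hy => ?_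
        rw [hγ] at hy
        exact hy w hw
      | keep _ _ _ w hw hwW xs ys hLP hys =>
        exact ih _ (hlt w hw hwW) x N _ hy hN (hW.insert subset_rfl hLP.2 hys) rfl
      | update _ _ _ w hw hwW xs ys hLP hys N' hN' =>
        exact ih _ (hlt w hw hwW) xs N' _ (hLP.1.2 hy) hN'
          (hW.insert hLP.1.2 hLP.2 hLP.1.1) rfl

lemma terminates_computeMinimizer (h : IsSystem H G C B A b) (hG0 : G 0 = (C : Set (Euc q)))
    (hint : (interior (C : Set (Euc q))).Nonempty) {ybar : Euc q}
    (hy : ∃ x, ybar ∈ H x + (C : Set (Euc q))) :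
    Terminates (CMStep H C ybar) (IsCorrectReturn H G C ybar) .start := by
  refine .step _ ?_ fun s' hs' => ?_
  · obtain ⟨x, hx⟩ := hy
    obtain ⟨N, hN⟩ := h.exists_isMinimalNormalSystem ⟨_, hx⟩
    exact ⟨_, .init x N hx hN⟩
  · cases hs' with
    | init x N hx hN =>
      exact h.terminates_loop hG0 hint ybar x N ∅ hx hN (fun w hw => absurd hw (by simp))

end IsSystem

/-! ### Correctness of the solution method -/

/-- The intended results of the solution method. -/
def IsCorrectResult (F : Euc n → Set (Euc q)) (C : PointedCone ℝ (Euc q)) (s : State n q) : Prop :=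
  (s = .noSolution ∧ ¬ ∃ S T, IsSolution F C S T) ∨
    ∃ S T, s = .finished S T ∧ IsSolution F C S T

lemma terminates_noSolution (h : ¬ ∃ S T, IsSolution F C S T) :
    Terminates (Step F C) (IsCorrectResult F C) .noSolution :=
  .halt _ (fun _ h => nomatch h) (Or.inl ⟨rfl, h⟩)

/-- Minimizers covering the points and the directions outside `C` of a V-representation of the upper
image form a solution. -/
lemma isSolution_of_isVRep {P D : Finset (Euc q)} {S T : Set (Euc n)}
    (hne : (upperImage F C).Nonempty) (hPD : IsVRep (upperImage F C) P D) (hSfin : S.Finite) (hTfin : T.Finite)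
    (hS : ∀ x ∈ S, IsMinimizingPoint F C x) (hT : ∀ x ∈ T, IsMinimizingDirection F C x)
    (hP : ∀ y ∈ P, ∃ x ∈ S, y ∈ F x + (C : Set (Euc q)))
    (hD : ∀ y ∈ D, y ∉ C → ∃ x ∈ T, y ∈ recMap F x + (C : Set (Euc q))) :
    IsSolution F C S T := by
  refine ⟨⟨hSfin, hTfin, ?_, fun x hx => (hS x hx).1, fun x hx => ⟨(hT x hx).2.1, (hT x hx).1⟩, ?_⟩,
    hS, hT⟩
  · rw [hPD] at hne
    obtain ⟨y, hy⟩ := convexHull_nonempty_iff.1 hne.of_add_left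
    exact (hP y hy).imp fun x hx => hx.1
  set X := convexHull ℝ (⋃ x ∈ S, F x)
  set K := PointedCone.hull ℝ (⋃ x ∈ T, recMap F x)
  -- The right-hand side is the sum of the convex set `X` and the convex cone `C + K`.
  have hRHS : (C : Set (Euc q)) + X + (K : Set (Euc q)) = X + ((C ⊔ K : PointedCone ℝ (Euc q)) :
      Set (Euc q)) := by
    rw [Submodule.coe_sup, add_comm (C : Set (Euc q)) X, add_assoc]
  rw [hPD, hRHS]
  have hconv : Convex ℝ (X + ((C ⊔ K : PointedCone ℝ (Euc q)) : Set (Euc q))) :=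
    (convex_convexHull ℝ _).add (PointedCone.convex _)
  have hpts : convexHull ℝ (P : Set (Euc q)) ⊆ X + ((C ⊔ K : PointedCone ℝ (Euc q)) :
      Set (Euc q)) := by
    refine convexHull_min (fun y hy => ?_) hconv
    obtain ⟨x, hx, u, hu, c, hc, rfl⟩ := hP y hy
    exact ⟨u, subset_convexHull ℝ _ (Set.mem_biUnion hx hu), c, Submodule.mem_sup_left hc, rfl⟩
  have hdir : PointedCone.hull ℝ (D : Set (Euc q)) ≤ C ⊔ K := by
    refine Submodule.span_le.2 fun y hy => ?_
    by_cases hyC : y ∈ C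
    · exact Submodule.mem_sup_left hyC
    obtain ⟨x, hx, u, hu, c, hc, rfl⟩ := hD y hy hyC
    exact add_mem (Submodule.mem_sup_right (Submodule.subset_span (Set.mem_biUnion hx hu)))
      (Submodule.mem_sup_left hc)
  rintro _ ⟨p, hp, d, hd, rfl⟩
  obtain ⟨u, hu, c, hc, rfl⟩ := hpts hp
  exact ⟨u, hu, c + d, add_mem hc (hdir hd), (add_assoc u c d).symm⟩

section Loops

variable {ι : Type} [Finite ι] {B : ι → Euc n →ₗ[ℝ] ℝ} {A : ι → Euc q →ₗ[ℝ] ℝ} {b : ι → ℝ}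

lemma terminates_directions (h : IsSystem F (recMap F) C B A b)
    (hG0 : recMap F 0 = (C : Set (Euc q))) (hint : (interior (C : Set (Euc q))).Nonempty)
    (hmin : IsMinimizer (recMap F) C 0) (hne : (upperImage F C).Nonempty) {P D : Finset (Euc q)}
    (hPD : IsVRep (upperImage F C) P D) {S : Set (Euc n)} (hSfin : S.Finite)
    (hS : ∀ x ∈ S, IsMinimizingPoint F C x)
    (hP : ∀ y ∈ P, ∃ x ∈ S, y ∈ F x + (C : Set (Euc q)))
    (E : Set (Euc q)) (T : Set (Euc n)) (hED : E ⊆ (D : Set (Euc q)) \ (C : Set (Euc q)))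
    (hTfin : T.Finite) (hT : ∀ x ∈ T, IsMinimizingDirection F C x)
    (hD : ∀ y ∈ D, y ∉ C → y ∉ E → ∃ x ∈ T, y ∈ recMap F x + (C : Set (Euc q))) :
    Terminates (Step F C) (IsCorrectResult F C) (.directions E S T) := by
  have hEfin : E.Finite := D.finite_toSet.sdiff.subset hED
  induction hk : E.ncard using Nat.strong_induction_on generalizing E T with
  | _ k ih =>
    rcases E.eq_empty_or_nonempty with rfl | hE
    · refine .step _ ⟨_, .directionsDone S T⟩ fun s' hs' => ?_
      cases hs' with
      | directionChoose _ _ _ y hy => exact absurd hy (by simp)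
      | directionsDone =>
        exact .halt _ (fun _ h => nomatch h) (Or.inr ⟨S, T, rfl, isSolution_of_isVRep hne hPD
          hSfin hTfin hS hT hP fun y hy hyC => hD y hy hyC (by simp)⟩)
    · refine .step _ (hE.imp' _ fun y hy => .directionChoose E S T y hy) fun s' hs' => ?_
      cases hs' with
      | directionsDone => simp at hE
      | directionChoose _ _ _ y hy =>
        have hyC : y ∉ C := (hED hy).2
        refine Terminates.embed (fun c => State.directionCall y c (E \ {y}) S T)
          (h.recession.terminates_computeMinimizer hG0 hint
            (h.exists_mem_rec_of_isVRep hne hPD (hED hy).1))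
          (fun c c' => .directionStep y c c' _ S T) ?_ ?_
        · rintro c s' ⟨c', hc'⟩ hs'
          cases hs' with
          | directionStep _ _ c'' _ _ _ h' => exact ⟨c'', h', rfl⟩
          | directionReturn => cases hc'
        · rintro c (⟨-, hno⟩ | ⟨x, rfl, hx, -, hyx⟩)
          · exact absurd hmin hno
          refine .step _ ⟨_, .directionReturn y {x} _ S T⟩ fun s' hs' => ?_
          cases hs' with
          | directionStep _ _ _ _ _ _ h' => cases h'
          | directionReturn =>
            -- Directions in `C` were removed so that the returned minimizer is not `0`.
            have hx0 : x ≠ 0 := by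
              rintro rfl
              obtain ⟨u, hu, c, hc, rfl⟩ := hyx
              rw [hG0] at hu
              exact hyC (add_mem hu hc)
            refine ih _ ?_ (E \ {y}) (T ∪ {x}) (Set.sdiff_subset.trans hED)
              (hTfin.union (Set.finite_singleton x)) ?_ ?_ hEfin.sdiff rfl
            · rw [← hk]
              exact Set.ncard_sdiff_singleton_lt_of_mem hy hEfin
            · rintro x' (hx' | rfl)
              · exact hT x' hx'
              · exact ⟨hx0, hx⟩
            · intro y' hy' hyC' hyE'
              by_cases hyy : y' = y
              · subst hyy
                exact ⟨x, Or.inr rfl, hyx⟩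
              · obtain ⟨x', hx', hm⟩ := hD y' hy' hyC' fun h' => hyE' ⟨h', hyy⟩
                exact ⟨x', Or.inl hx', hm⟩

lemma terminates_points (h : IsSystem F (recMap F) C B A b)
    (hG0 : recMap F 0 = (C : Set (Euc q))) (hint : (interior (C : Set (Euc q))).Nonempty)
    (hmin : IsMinimizer (recMap F) C 0) (hne : (upperImage F C).Nonempty) {P D : Finset (Euc q)}
    (hPD : IsVRep (upperImage F C) P D)
    (E : Set (Euc q)) (S : Set (Euc n)) (hEP : E ⊆ (P : Set (Euc q))) (hSfin : S.Finite)
    (hS : ∀ x ∈ S, IsMinimizingPoint F C x)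
    (hP : ∀ y ∈ P, y ∉ E → ∃ x ∈ S, y ∈ F x + (C : Set (Euc q))) :
    Terminates (Step F C) (IsCorrectResult F C)
      (.points E ((D : Set (Euc q)) \ (C : Set (Euc q))) S) := by
  have hEfin : E.Finite := P.finite_toSet.subset hEP
  have hPmem : ∀ y ∈ P, ∃ x, y ∈ F x + (C : Set (Euc q)) := fun y hy => by
    rw [← mem_upperImage, hPD]
    exact ⟨y, subset_convexHull ℝ _ hy, 0, zero_mem _, add_zero y⟩
  induction hk : E.ncard using Nat.strong_induction_on generalizing E S with
  | _ k ih =>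
    rcases E.eq_empty_or_nonempty with rfl | hE
    · refine .step _ ⟨_, .pointsDone _ S⟩ fun s' hs' => ?_
      cases hs' with
      | pointChoose _ _ _ y hy => exact absurd hy (by simp)
      | pointsDone =>
        exact terminates_directions h hG0 hint hmin hne hPD hSfin hS
          (fun y hy => hP y hy (by simp)) _ ∅ subset_rfl Set.finite_empty (by simp)
          fun y hy hyC hyE => absurd ⟨hy, hyC⟩ hyE
    · refine .step _ (hE.imp' _ fun y hy => .pointChoose E _ S y hy) fun s' hs' => ?_
      cases hs' with
      | pointsDone => simp at hE
      | pointChoose _ _ _ y hy =>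
        refine Terminates.embed (fun c => State.pointCall y c (E \ {y}) _ S)
          (h.terminates_computeMinimizer hG0 hint (hPmem y (hEP hy)))
          (fun c c' => .pointStep y c c' _ _ S) ?_ ?_
        · rintro c s' ⟨c', hc'⟩ hs'
          cases hs' with
          | pointStep _ _ c'' _ _ _ h' => exact ⟨c'', h', rfl⟩
          | pointReturn => cases hc'
        · rintro c (⟨-, hno⟩ | ⟨x, rfl, hx, -, hyx⟩)
          · exact absurd hmin hno
          refine .step _ ⟨_, .pointReturn y {x} _ _ S⟩ fun s' hs' => ?_
          cases hs' with
          | pointStep _ _ _ _ _ _ h' => cases h'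
          | pointReturn =>
            refine ih _ ?_ (E \ {y}) (S ∪ {x}) (Set.sdiff_subset.trans hEP)
              (hSfin.union (Set.finite_singleton x)) ?_ ?_ hEfin.sdiff rfl
            · rw [← hk]
              exact Set.ncard_sdiff_singleton_lt_of_mem hy hEfin
            · rintro x' (hx' | rfl)
              · exact hS x' hx'
              · exact hx
            · intro y' hy' hyE'
              by_cases hyy : y' = y
              · subst hyy
                exact ⟨x, Or.inr rfl, hyx⟩
              · obtain ⟨x', hx', hm⟩ := hP y' hy' fun h' => hyE' ⟨h', hyy⟩
                exact ⟨x', Or.inl hx', hm⟩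

lemma terminates_test (h : IsSystem F (recMap F) C B A b)
    (hG0 : recMap F 0 = (C : Set (Euc q))) (hint : (interior (C : Set (Euc q))).Nonempty)
    (hne : (upperImage F C).Nonempty) :
    Terminates (Step F C) (IsCorrectResult F C) (.test .start) := by
  refine Terminates.embed State.test
    (h.recession.terminates_computeMinimizer hG0 hint (ybar := 0) ⟨0, 0, ?_, 0, C.zero_mem, ?_⟩)
    (fun c c' => .testStep c c') ?_ ?_
  · rw [hG0]; exact C.zero_mem
  · exact add_zero 0
  · rintro c s' ⟨c', hc'⟩ hs'
    cases hs' with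
    | testStep _ c'' h' => exact ⟨c'', h', rfl⟩
    | testFail => cases hc'
    | testPass => cases hc'
  · rintro c (⟨rfl, hno⟩ | ⟨x, rfl, -, hmin, -⟩)
    · refine .step _ ⟨_, .testFail ∅ rfl⟩ fun s' hs' => ?_
      cases hs' with
      | testStep _ _ h' => cases h'
      | testPass _ h' => exact absurd rfl h'
      | testFail =>
        refine terminates_noSolution ?_
        rintro ⟨S, T, hsol, hS, -⟩
        obtain ⟨x, hx⟩ := hsol.nonempty_points
        exact hno (h.isMinimizer_rec_zero hG0 (hS x hx))
    · refine .step _ ⟨_, .testPass {x} (Set.singleton_ne_empty x)⟩ fun s' hs' => ?_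
      cases hs' with
      | testStep _ _ h' => cases h'
      | testFail _ h' => exact absurd h' (Set.singleton_ne_empty x)
      | testPass =>
        obtain ⟨P, D, hPD⟩ := h.exists_isVRep_upperImage hne
        refine .step _ ⟨_, .compute P D hPD⟩ fun s' hs' => ?_
        cases hs' with
        | compute P D hPD =>
          exact terminates_points h hG0 hint hmin hne hPD _ ∅ subset_rfl Set.finite_empty (by simp)
            fun y hy hyP => absurd hy hyP

end Loops

lemma terminates_start (hF : IsPolyhedron (graph F)) (hC : IsPolyhedron (C : Set (Euc q)))
    (hint : (interior (C : Set (Euc q))).Nonempty)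
    (hG : (graph F).Nonempty → recMap F 0 = (C : Set (Euc q))) :
    Terminates (Step F C) (IsCorrectResult F C) .start := by
  by_cases hne : upperImage F C = ∅
  · refine .step _ ⟨_, .infeasible hne⟩ fun s' hs' => ?_
    cases hs' with
    | feasible h' => exact absurd hne h'
    | infeasible =>
      refine terminates_noSolution ?_
      rintro ⟨S, T, hsol, -, -⟩
      obtain ⟨x, hx⟩ := hsol.nonempty_points
      obtain ⟨y, hy⟩ := hsol.points_subset hx
      exact hne.le (mem_upperImage.2 ⟨x, y, hy, 0, C.zero_mem, add_zero y⟩)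
  · refine .step _ ⟨_, .feasible hne⟩ fun s' hs' => ?_
    cases hs' with
    | infeasible h' => exact absurd h' hne
    | feasible =>
      have hne' := Set.nonempty_iff_ne_empty.2 hne
      have hgr : (graph F).Nonempty := by
        obtain ⟨y, hy⟩ := hne'
        obtain ⟨x, u, hu, -⟩ := mem_upperImage.1 hy
        exact ⟨(x, u), hu⟩
      obtain ⟨ι, _, B, A, b, h⟩ := exists_isSystem hF hC hgr
      exact terminates_test h (hG hgr) hint hne'

end PolySetOpt

theorem mainTheorem1 (n q : ℕ) (F : PolySetOpt.Euc n → Set (PolySetOpt.Euc q))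
    (C : PointedCone ℝ (PolySetOpt.Euc q))
    (hF : PolySetOpt.IsPolyhedron (PolySetOpt.graph F))
    (hC : PolySetOpt.IsPolyhedron (C : Set (PolySetOpt.Euc q)))
    (hint : (interior (C : Set (PolySetOpt.Euc q))).Nonempty)
    (hG : (PolySetOpt.graph F).Nonempty →
      PolySetOpt.recMap F 0 = (C : Set (PolySetOpt.Euc q))) :
    -- no run is infinite
    (¬ ∃ s : ℕ → PolySetOpt.State n q, s 0 = .start ∧
        ∀ k, PolySetOpt.Step F C (s k) (s (k + 1))) ∧
    -- no run gets stuck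
    (∀ s, PolySetOpt.Reachable F C s → s.IsFinal ∨ ∃ s', PolySetOpt.Step F C s s') ∧
    -- if there is a solution, then every run that has stopped has returned one
    ((∃ S T, PolySetOpt.IsSolution F C S T) →
      ∀ s, PolySetOpt.Reachable F C s → s.IsFinal →
        ∃ S T, s = .finished S T ∧ PolySetOpt.IsSolution F C S T) ∧
    -- otherwise every run that has stopped has reported that there is none
    ((¬ ∃ S T, PolySetOpt.IsSolution F C S T) →
      ∀ s, PolySetOpt.Reachable F C s → s.IsFinal → s = .noSolution) := by
  have hstart := PolySetOpt.terminates_start hF hC hint hG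
  have hfinal : ∀ s, PolySetOpt.Reachable F C s → s.IsFinal →
      PolySetOpt.IsCorrectResult F C s := by
    intro s hs hfin
    refine (hstart.of_reflTransGen hs).post_or_exists_step.resolve_right ?_
    rintro ⟨s', hs'⟩
    rcases hfin with rfl | ⟨S, T, rfl⟩ <;> cases hs'
  refine ⟨hstart.not_exists_infinite, fun s hs => ?_, fun hsol s hs hfin => ?_,
    fun hsol s hs hfin => ?_⟩
  · refine (hstart.of_reflTransGen hs).post_or_exists_step.imp_left ?_
    rintro (⟨rfl, -⟩ | ⟨S, T, rfl, -⟩)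
    · exact Or.inl rfl
    · exact Or.inr ⟨S, T, rfl⟩
  · exact (hfinal s hs hfin).resolve_left fun h => h.2 hsol
  · rcases hfinal s hs hfin with h | ⟨S, T, -, h⟩
    · exact h.1
    · exact absurd ⟨S, T, h⟩ hsol
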